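/- Let $m\ge 2$ variables be observed at $p\ge 1$ locations, and let $(\mathcal W_t)_{t\in\mathbb Z}$, $\mathcal W_t=(X_t^1,\dots,X_t^m)\in\mathbb R^{mp}$, be a stationary VAR(1) process $$X_t^i=\sum_{j=1}^m \gamma_{ij}^\star\Theta_{ij}^\star X_{t-1}^j+\epsilon_t^i,\qquad i=1,\dots,m,$$ where the innovation $\epsilon_t=(\epsilon^1_t,\dots,\epsilon^m_t)\sim\mathcal N(0,\sigma^2 I_{mp})$ is independent of $(\mathcal W_s)_{s<t}$. Let $\mathcal J_0\subseteq\{1,\dots,p\}^2$ be a given spatial structure. Assume that every $\Theta^\star_{ij}\in\mathbb R^{p\times p}$ is supported on $\mathcal J_0$, that $\|\Theta_{ij}^\star\|_F=1$ if $\gamma_{ij}^\star\ne 0$ and $\Theta_{ij}^\star=0$ if $\gamma_{ij}^\star=0$, and that $|\gamma^\star_{ij}|\le C_\Gamma$. Write $s_\Gamma$ for the number of nonzero entries of $\Gamma^\star=(\gamma_{ij}^\star)$, $s_\Omega=|\mathcal J_0|$, $\beta_\Gamma^\star=\mathrm{vec}(\Gamma^\star)$, and $\mathbf B^\star$ for the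 $mp\times mp$ matrix with blocks $\gamma^\star_{ij}\Theta^\star_{ij}$. Assume that the spectral density $f(\theta)=\frac1{2\pi}\sum_{l\in\mathbb Z}\mathrm{Cov}(\mathcal W_0,\mathcal W_l)e^{-il\theta}$ exists and has all its eigenvalues in $[\mathfrak m,\mathcal M]$ for $\theta\in[-\pi,\pi]$, where $0<\mathfrak m\le\mathcal M<\infty$, and that $\det(I-\mathbf B^\star z)\neq0$ for all complex $z$ with $|z|=1$. For an array $\widehat\Theta=(\widehat\Theta_{ij})$ let $\mathbf X_\Theta$ be the design matrix of the $\Gamma$-update: its column $(i,j)$ has the entries of the vectors $\widehat\Theta_{ij}X^j_{t-1}$, $t=1,\dots,T$, in the rows belonging to response variable $i$, and zeros elsewhere. Let $\mathbf y$ be the stacked responses $X_t^i$, and put $\widehat\gamma_\Theta=\mathbf X_\Theta'\mathbf y/T$, $\widehat{\mathfrak X}_\Theta=\mathbf X_\Theta'\mathbf X_\Theta/T$. A Lasso update $\widehat\beta_\Gamma$ with tuning parameter $\lambda_T$ is any minimizer over $\beta\in\mathbb R^{m^2}$ of $-2\beta'\widehat\gamma_\Theta+\beta'\widehat{\mathfrak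 X}_\Theta\beta+\lambda_T\|\beta\|_1$. **Theorem.** There are universal constants $c_1,c_2,c_3,c_4,C_0>0$; constants $\alpha_\Gamma>0$, $\varphi_\Gamma\ge0$ depending only on $\mathfrak m,\mathcal M,\sigma$; and, for each $\eta_\Theta>0$, a positive deterministic function $\mathbb Q(\nu)=\mathbb Q(\log p/\log m,\nu)$, nondecreasing in both arguments and depending otherwise only on $\mathfrak m,\mathcal M,\sigma,C_\Gamma,s_\Gamma,s_\Omega,\eta_\Theta$, such that the following holds. Let $T\ge C_0(\log m+\log p)$ and $\nu_\Theta=\eta_\Theta\sqrt{(\log p+\log m)/T}$. Then, with probability at least $$1-c_1e^{-c_2(\log m+\log p)}-c_3T^{-c_4},$$ for every $\widehat\Theta$ supported on $\mathcal J_0$ with $\max_{i,j,s,s'}|\widehat\Theta_{ij}(s,s')-\Theta^\star_{ij}(s,s')|\le\nu_\Theta$: the restricted eigenvalue condition $u'\widehat{\mathfrak X}_\Theta u\ge\alpha_\Gamma\|u\|_2^2-\varphi_\Gamma\|u\|_1^2$ holds for all $u\in\mathbb R^{m^2}$; the deviation bound $\|\widehat\gamma_\Theta-\widehat{\mathfrak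 X}_\Theta\beta_\Gamma^\star\|_\infty\le\mathbb Q(\nu_\Theta)\sqrt{\log m/T}$ holds; and for every $\lambda_T\ge4\,\mathbb Q(\nu_\Theta)\sqrt{\log m/T}$, every Lasso update satisfies $$\|\widehat\beta_\Gamma-\beta_\Gamma^\star\|_1\le\frac{48\,s_\Gamma}{\alpha_\Gamma}\lambda_T .$$ -/

import Mathlib

open MeasureTheory ProbabilityTheory Real

noncomputable section

namespace SpatialVAR

/-- Index set of the stacked process: `(i, s)` stands for variable `i` at location `s`. -/
abbrev Idx (m p : ℕ) : Type := Fin m × Fin p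

/-- An `m × m` array of `p × p` spatial blocks `Θ_{ij}`. -/
abbrev Blocks (m p : ℕ) : Type := Fin m → Fin m → Matrix (Fin p) (Fin p) ℝ

/-- Every block has its sparsity pattern inside the spatial structure `J₀`. -/
def SupportedOn {m p : ℕ} (J₀ : Finset (Fin p × Fin p)) (Θ : Blocks m p) : Prop :=
  ∀ i j s s', Θ i j s s' ≠ 0 → (s, s') ∈ J₀

/-- The true parameters: blocks supported on `J₀`, active blocks of Frobenius norm one,
and inactive blocks equal to zero. -/
structure IsNormalized {m p : ℕ} (J₀ : Finset (Fin p × Fin p))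
    (Γ : Matrix (Fin m) (Fin m) ℝ) (Θ : Blocks m p) : Prop where
  supported : SupportedOn J₀ Θ
  active : ∀ i j, Γ i j ≠ 0 → √(∑ s, ∑ s', Θ i j s s' ^ 2) = 1
  inactive : ∀ i j, Γ i j = 0 → Θ i j = 0

/-- The number of nonzero entries of `Γ`. -/
def sparsity {m : ℕ} (Γ : Matrix (Fin m) (Fin m) ℝ) : ℕ :=
  (Finset.univ.filter fun ij : Fin m × Fin m => Γ ij.1 ij.2 ≠ 0).card

/-- The transition matrix with blocks `B_{ij} = γ_{ij} Θ_{ij}`. -/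
def transition {m p : ℕ} (Γ : Matrix (Fin m) (Fin m) ℝ) (Θ : Blocks m p) :
    Matrix (Idx m p) (Idx m p) ℝ :=
  Matrix.of fun a b => Γ a.1 b.1 * Θ a.1 b.1 a.2 b.2

/-- `W` is a (second-order) stationary solution of `W_t = B W_{t-1} + ε_t`, where the innovation
`ε_t` has independent `N(0, σ²)` coordinates and is independent of the past of `W`. -/
structure IsStationaryVAR {ι : Type*} [Fintype ι] {Ω : Type*} [MeasurableSpace Ω]
    (μ : Measure Ω) (B : Matrix ι ι ℝ) (σ : ℝ) (W ε : ℤ → Ω → ι → ℝ) : Prop where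
  measurable_W : ∀ t, Measurable (W t)
  measurable_noise : ∀ t, Measurable (ε t)
  recursion : ∀ t, ∀ᵐ ω ∂μ, W t ω = B.mulVec (W (t - 1) ω) + ε t ω
  noise_law : ∀ t, μ.map (ε t) = Measure.pi fun _ : ι => gaussianReal 0 (σ ^ 2).toNNReal
  innovation : ∀ t, IndepFun (ε t) (fun ω (s : Set.Iio t) => W s ω) μ
  memLp : ∀ t a, MemLp (fun ω => W t ω a) 2 μ
  mean_eq : ∀ t a, ∫ ω, W t ω a ∂μ = ∫ ω, W 0 ω a ∂μ
  cov_eq : ∀ t h a b, covariance (fun ω => W t ω a) (fun ω => W (t + h) ω b) μ =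
    covariance (fun ω => W 0 ω a) (fun ω => W h ω b) μ

/-- Autocovariance `Γ_W(h) = Cov(W_t, W_{t+h})` of a stationary process (taken at `t = 0`). -/
def autocov {ι : Type*} {Ω : Type*} [MeasurableSpace Ω] (μ : Measure Ω)
    (W : ℤ → Ω → ι → ℝ) (h : ℤ) : Matrix ι ι ℝ :=
  Matrix.of fun a b => covariance (fun ω => W 0 ω a) (fun ω => W h ω b) μ

/-- Spectral density `f_W(θ) = (2π)⁻¹ ∑_l Γ_W(l) exp(-i l θ)`. -/
def spectralDensity {ι : Type*} {Ω : Type*} [MeasurableSpace Ω] (μ : Measure Ω)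
    (W : ℤ → Ω → ι → ℝ) (θ : ℝ) : Matrix ι ι ℂ :=
  Matrix.of fun a b => (1 / (2 * (π : ℂ))) *
    ∑' l : ℤ, (autocov μ W l a b : ℂ) * Complex.exp (-(Complex.I * l * θ))

/-- Stability with explicit constants: the spectral density series converges, the eigenvalues of
the spectral density lie in `[lo, hi]` on `[-π, π]` (that is, `lo ≤ 𝔪(f_W)` and `ℳ(f_W) ≤ hi`),
and the characteristic polynomial `det (I - B z)` has no zero on the unit circle. -/
structure IsStable {ι : Type*} [Fintype ι] [DecidableEq ι] {Ω : Type*} [MeasurableSpace Ω]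
    (μ : Measure Ω) (B : Matrix ι ι ℝ) (W : ℤ → Ω → ι → ℝ) (lo hi : ℝ) : Prop where
  summable : ∀ a b, Summable fun l : ℤ => autocov μ W l a b
  eigenvalues : ∀ θ ∈ Set.Icc (-π) π, spectrum ℝ (spectralDensity μ W θ) ⊆ Set.Icc lo hi
  charpoly : ∀ z : ℂ, ‖z‖ = 1 → (1 - z • B.map (fun x => (x : ℂ))).det ≠ 0

/-- The design matrix `X_Θ` of the `Γ`-update, from the sample path `x = (x_0, …, x_T)`: the
column of the pair `(i, j)` lists the vectors `Θ_{ij} x^j_{t-1}` in the rows of response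
variable `i`. The row index `t : Fin T` stands for the time `t + 1`. -/
def design {m p : ℕ} (T : ℕ) (Θ : Blocks m p) (x : ℕ → Idx m p → ℝ) :
    Matrix (Fin T × Fin m × Fin p) (Fin m × Fin m) ℝ :=
  Matrix.of fun r c =>
    if r.2.1 = c.1 then (Θ c.1 c.2).mulVec (fun s => x r.1 (c.2, s)) r.2.2 else 0

/-- The stacked response `y`, with entries `x^i_t(s)` for `t = 1, …, T`. -/
def response {m p : ℕ} (T : ℕ) (x : ℕ → Idx m p → ℝ) : Fin T × Fin m × Fin p → ℝ :=
  fun r => x (r.1 + 1) r.2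

/-- `γ̂_Θ = X_Θ' y / T`. -/
def gammaHat {m p : ℕ} (T : ℕ) (Θ : Blocks m p) (x : ℕ → Idx m p → ℝ) : Fin m × Fin m → ℝ :=
  (1 / (T : ℝ)) • (design T Θ x).transpose.mulVec (response T x)

/-- The empirical Gram matrix `X_Θ' X_Θ / T`. -/
def gram {m p : ℕ} (T : ℕ) (Θ : Blocks m p) (x : ℕ → Idx m p → ℝ) :
    Matrix (Fin m × Fin m) (Fin m × Fin m) ℝ :=
  (1 / (T : ℝ)) • ((design T Θ x).transpose * design T Θ x)

/-- The vectorized `ℓ₁` norm. -/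
def l1 {ι : Type*} [Fintype ι] (β : ι → ℝ) : ℝ := ∑ k, |β k|

/-- `β_Γ = vec Γ`. -/
def betaOf {m : ℕ} (Γ : Matrix (Fin m) (Fin m) ℝ) : Fin m × Fin m → ℝ := fun ij => Γ ij.1 ij.2

/-- The Lasso objective `-2 β' γ̂_Θ + β' 𝔛̂_Θ β + lam ‖β‖₁` of the `Γ`-update. -/
def objective {m p : ℕ} (T : ℕ) (Θ : Blocks m p) (x : ℕ → Idx m p → ℝ) (lam : ℝ)
    (β : Fin m × Fin m → ℝ) : ℝ :=
  -2 * (β ⬝ᵥ gammaHat T Θ x) + β ⬝ᵥ (gram T Θ x).mulVec β + lam * l1 β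

/-- Restricted eigenvalue condition `RE(α, φ)`. -/
def RE {ι : Type*} [Fintype ι] (A : Matrix ι ι ℝ) (α φ : ℝ) : Prop :=
  ∀ u : ι → ℝ, α * ∑ k, u k ^ 2 - φ * l1 u ^ 2 ≤ u ⬝ᵥ A.mulVec u

/-- Deviation bound `‖γ̂_Θ - 𝔛̂_Θ β_Γ‖_∞ ≤ δ`. -/
def DeviationBound {m p : ℕ} (T : ℕ) (Θ : Blocks m p) (x : ℕ → Idx m p → ℝ)
    (Γ : Matrix (Fin m) (Fin m) ℝ) (δ : ℝ) : Prop :=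
  ∀ k, |gammaHat T Θ x k - (gram T Θ x).mulVec (betaOf Γ) k| ≤ δ

end SpatialVAR

end

/-!
# Lasso updates for a vector autoregression with spatial structure

*Reduction to a small resolution.* Put `L = log m + log p` and `δ = √(L / T)`, so that
`ν_Θ = η δ`. Since `Q` may depend on `log p / log m`, the choice `Q r ν = K (1 + ν) √(1 + r)` gives
`Q √(log m / T) = K (1 + ν) δ`. A Lasso minimizer satisfies `‖β̂ - β⋆‖₁ ≤ 4 ‖β⋆‖₁ ≤ 4 s_Γ C_Γ`
whenever the penalty dominates the deviation (`l1_error_le_four_mul`), so for `δ` above a threshold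
the error bound follows as soon as `K` is large. Below the threshold, curvature is needed.

*Curvature.* For an inactive pair `Θ⋆_{ij} = 0`, so its column of the design is of size `ν_Θ` only
and hardly contributes on the Lasso cone. On the active coordinates `v`, the prediction is
`⟨c, W_t⟩ = ⟨c, B W_{t-1}⟩ + ⟨c, ε_t⟩`. Dropping the square of the first summand leaves the energy of
the innovations, about `σ² ‖v_S‖²`, and a cross term that is a martingale (`IsTypical.curvature`).
Hence `α_Γ = σ²` works. The same inactive columns, which vanish when `Θ̂_{ij} = 0`, show that the
restricted eigenvalue condition requires `φ_Γ ≥ α_Γ`; the choice here is `φ_Γ = α_Γ`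
(`gram_RE`), and the error bound does not go through that condition but through the curvature on
the cone.

*Deviation.* The residual `y - X_Θ̂ β⋆` consists of the innovations and of `(Θ⋆ - Θ̂)` applied to the
active blocks. It is correlated with the columns by at most a constant times `(1 + ν_Θ) δ`
(`IsTypical.deviation_le`).

*Probability.* What is used about the path is collected in `IsTypical`: `∑ W_{t,a}²` is at most a
constant times `T`, and `∑ W_{t,a} ε_{t+1,b}` and `∑ (ε_{t,a} ε_{t,b} - σ² δ_{ab})` are at most a
constant times `√(L T)`, for all coordinates. The last two are controlled by exponential
supermartingales (`lintegral_prod_le_one`), the first of them relative to its quadratic variation.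
For the energy, linear functionals of the path are sub-Gaussian with their variance as proxy, since
the recursion exhibits them as limits of sums of independent Gaussian variables
(`lintegral_ennexp_sum_dotProduct_le`). The variance of `∑ x_t W_{t,a}` is a Toeplitz form, bounded
by `2 π hi ‖x‖²` through the spectral density (`IsStable.variance_sum_le`), and a Gaussian
average over `x` yields an exponential moment of `∑ W_{t,a}²`
(`IsStable.lintegral_ennexp_sum_sq_le`).
-/

set_option linter.unusedSectionVars false

namespace SpatialVAR

/-! ### Exponential moments of Gaussian vectors -/

/-- The exponential of a real number as an element of `[0, ∞]`, so that exponential moments are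
lower Lebesgue integrals and need no integrability. -/
noncomputable def ennexp (x : ℝ) : ENNReal := ENNReal.ofReal (Real.exp x)

lemma ennexp_add (x y : ℝ) : ennexp (x + y) = ennexp x * ennexp y := by
  rw [ennexp, Real.exp_add, ENNReal.ofReal_mul (Real.exp_pos x).le]; rfl

lemma ennexp_zero : ennexp 0 = 1 := by simp [ennexp]

lemma ennexp_mono {x y : ℝ} (h : x ≤ y) : ennexp x ≤ ennexp y :=
  ENNReal.ofReal_le_ofReal (Real.exp_le_exp.2 h)

lemma ennexp_ne_zero (x : ℝ) : ennexp x ≠ 0 := by simp [ennexp, Real.exp_pos]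

lemma ennexp_ne_top (x : ℝ) : ennexp x ≠ ⊤ := ENNReal.ofReal_ne_top

lemma ennexp_sum {ι : Type*} (s : Finset ι) (f : ι → ℝ) :
    ennexp (∑ i ∈ s, f i) = ∏ i ∈ s, ennexp (f i) := by
  rw [ennexp, Real.exp_sum, ENNReal.ofReal_prod_of_nonneg fun i _ => (Real.exp_pos _).le]; rfl

lemma ennexp_neg_mul_self (x : ℝ) : ennexp (-x) * ennexp x = 1 := by
  rw [← ennexp_add, neg_add_cancel, ennexp_zero]

lemma continuous_ennexp : Continuous ennexp :=
  ENNReal.continuous_ofReal.comp Real.continuous_exp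

@[fun_prop]
lemma measurable_ennexp : Measurable ennexp := continuous_ennexp.measurable

/-- Chernoff's bound. -/
lemma measure_lt_le_of_lintegral_ennexp_le {Ω : Type*} [MeasurableSpace Ω] {μ : Measure Ω}
    {f : Ω → ℝ} (hf : Measurable f) {c : ℝ} (h : ∫⁻ ω, ennexp (f ω) ∂μ ≤ ennexp c) (x : ℝ) :
    μ {ω | x < f ω} ≤ ennexp (c - x) := by
  calc μ {ω | x < f ω} ≤ μ {ω | ennexp x ≤ ennexp (f ω)} :=
        measure_mono fun ω hω => ennexp_mono (le_of_lt hω)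
    _ ≤ (∫⁻ ω, ennexp (f ω) ∂μ) / ennexp x :=
        meas_ge_le_lintegral_div (by fun_prop) (ennexp_ne_zero x) (ennexp_ne_top x)
    _ ≤ ennexp c / ennexp x := by gcongr
    _ = ennexp (c - x) := by
        rw [div_eq_mul_inv, sub_eq_add_neg, ennexp_add]
        congr 1
        exact (ENNReal.eq_inv_of_mul_eq_one_left (ennexp_neg_mul_self x)).symm

/-- The law of one innovation vector: independent `N(0, σ²)` coordinates. -/
noncomputable abbrev noiseLaw (ι : Type*) [Fintype ι] (σ : ℝ) : Measure (ι → ℝ) :=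
  Measure.pi fun _ : ι => gaussianReal 0 (σ ^ 2).toNNReal

lemma lintegral_ennexp_mul_gaussianReal (σ c : ℝ) :
    ∫⁻ x, ennexp (c * x) ∂(gaussianReal 0 (σ ^ 2).toNNReal) = ennexp (σ ^ 2 * c ^ 2 / 2) := by
  unfold ennexp
  rw [← ofReal_integral_eq_lintegral_ofReal (integrable_exp_mul_gaussianReal c)
    (Filter.Eventually.of_forall fun x => (Real.exp_pos _).le)]
  have := congrFun (mgf_fun_id_gaussianReal (μ := 0) (v := (σ ^ 2).toNNReal)) c
  simp only [mgf] at this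
  rw [this, Real.coe_toNNReal _ (sq_nonneg σ)]
  congr 2; ring

lemma lintegral_pi_prod {ι : Type*} [Fintype ι] {X : Type*} [MeasurableSpace X]
    (ν : Measure X) [IsProbabilityMeasure ν] (f : ι → X → ENNReal) (hf : ∀ i, Measurable (f i)) :
    ∫⁻ e, ∏ i, f i (e i) ∂(Measure.pi fun _ : ι => ν) = ∏ i, ∫⁻ x, f i x ∂ν := by
  have h1 : iIndepFun (fun i (e : ι → X) => f i (e i)) (Measure.pi fun _ : ι => ν) :=
    iIndepFun_pi fun i => (hf i).aemeasurable
  rw [lintegral_prod_eq_prod_lintegral_of_indepFun Finset.univ _ h1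
    (fun i => (hf i).comp (measurable_pi_apply i))]
  refine Finset.prod_congr rfl fun i _ => ?_
  exact (measurePreserving_eval (fun _ : ι => ν) i).lintegral_comp (hf i)

lemma lintegral_ennexp_noiseLaw {ι : Type*} [Fintype ι] (σ : ℝ) (c : ι → ℝ) :
    ∫⁻ e, ennexp (∑ a, c a * e a) ∂(noiseLaw ι σ) = ennexp (σ ^ 2 * (∑ a, c a ^ 2) / 2) := by
  simp_rw [ennexp_sum]
  rw [lintegral_pi_prod _ (fun a x => ennexp (c a * x)) (fun a => by fun_prop)]
  simp_rw [lintegral_ennexp_mul_gaussianReal, ← ennexp_sum]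
  rw [← Finset.sum_div, Finset.mul_sum]

lemma lintegral_ennexp_mul_sq_gaussianReal {σ : ℝ} (hσ : 0 < σ) {θ : ℝ} (h : 2 * θ * σ ^ 2 < 1) :
    ∫⁻ x, ennexp (θ * x ^ 2) ∂(gaussianReal 0 (σ ^ 2).toNNReal) =
      ENNReal.ofReal (√(1 - 2 * θ * σ ^ 2))⁻¹ := by
  have hv : (σ ^ 2).toNNReal ≠ 0 := by
    rw [Ne, Real.toNNReal_eq_zero]; have := sq_pos_of_pos hσ; linarith
  rw [gaussianReal_of_var_ne_zero _ hv,
    lintegral_withDensity_eq_lintegral_mul _ (measurable_gaussianPDF _ _) (by fun_prop)]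
  set b : ℝ := (1 - 2 * θ * σ ^ 2) / (2 * σ ^ 2) with hb
  have hbpos : 0 < b := by
    have : 0 < 1 - 2 * θ * σ ^ 2 := by linarith
    positivity
  have hpt : ∀ x, (gaussianPDF 0 (σ ^ 2).toNNReal * fun x => ennexp (θ * x ^ 2)) x =
      ENNReal.ofReal ((√(2 * π * σ ^ 2))⁻¹ * Real.exp (-b * x ^ 2)) := by
    intro x
    simp only [Pi.mul_apply, gaussianPDF, gaussianPDFReal, ennexp]
    rw [← ENNReal.ofReal_mul (by positivity), mul_assoc, ← Real.exp_add,
      Real.coe_toNNReal _ (sq_nonneg σ)]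
    congr 3
    rw [hb]; field_simp; ring
  simp_rw [hpt]
  rw [← ofReal_integral_eq_lintegral_ofReal ((integrable_exp_neg_mul_sq hbpos).const_mul _)
    (Filter.Eventually.of_forall fun x => by positivity), integral_const_mul, integral_gaussian]
  congr 1
  rw [← Real.sqrt_inv, ← Real.sqrt_mul (by positivity), ← Real.sqrt_inv]
  congr 1
  have : 1 - 2 * θ * σ ^ 2 ≠ 0 := by linarith
  rw [hb]; field_simp

lemma inv_sqrt_one_sub_le_exp {y : ℝ} (h : |y| ≤ 1 / 2) :
    (√(1 - y))⁻¹ ≤ Real.exp (y / 2 + y ^ 2) := by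
  obtain ⟨h1, h2⟩ := abs_le.1 h
  have hpos : 0 < 1 - y := by linarith
  have key : Real.exp (-(y + 2 * y ^ 2)) ≤ 1 - y := by
    rw [← Real.le_log_iff_exp_le hpos]
    have hlog := Real.abs_log_sub_add_sum_range_le (x := y) (by linarith) 1
    have h3 : |y| ^ (1 + 1) / (1 - |y|) ≤ 2 * y ^ 2 := by
      rw [div_le_iff₀ (by linarith), one_add_one_eq_two, sq_abs]
      nlinarith [sq_nonneg y]
    have h4 := (abs_le.1 (hlog.trans h3)).1
    simp at h4
    linarith
  rw [← Real.sqrt_inv]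
  refine Real.sqrt_le_iff.2 ⟨(Real.exp_pos _).le, ?_⟩
  rw [← Real.exp_nat_mul, inv_le_comm₀ hpos (Real.exp_pos _), ← Real.exp_neg]
  rwa [show -(((2 : ℕ) : ℝ) * (y / 2 + y ^ 2)) = -(y + 2 * y ^ 2) by push_cast; ring]

lemma lintegral_ennexp_mul_sq_gaussianReal_le {σ : ℝ} (hσ : 0 < σ) {θ : ℝ}
    (h : |2 * θ * σ ^ 2| ≤ 1 / 2) :
    ∫⁻ x, ennexp (θ * x ^ 2) ∂(gaussianReal 0 (σ ^ 2).toNNReal) ≤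
      ennexp (θ * σ ^ 2 + 4 * (θ * σ ^ 2) ^ 2) := by
  rw [lintegral_ennexp_mul_sq_gaussianReal hσ (by have := (abs_le.1 h).2; linarith)]
  refine ENNReal.ofReal_le_ofReal ((inv_sqrt_one_sub_le_exp h).trans_eq ?_)
  congr 1; ring

/-- The centred products of two innovation coordinates are sub-exponential. -/
lemma lintegral_ennexp_mul_noiseLaw_le {ι : Type*} [Fintype ι] [DecidableEq ι] {σ : ℝ}
    (hσ : 0 < σ) {θ : ℝ} (h : |θ * σ ^ 2| ≤ 1 / 4) (a b : ι) :
    ∫⁻ e, ennexp (θ * (e a * e b - if a = b then σ ^ 2 else 0)) ∂(noiseLaw ι σ) ≤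
      ennexp (4 * (θ * σ ^ 2) ^ 2) := by
  set g := gaussianReal 0 (σ ^ 2).toNNReal with hg
  by_cases hab : a = b
  · subst hab
    simp only [if_true]
    have h0 : ∀ e : ι → ℝ, ennexp (θ * (e a * e a - σ ^ 2)) =
        ennexp (-(θ * σ ^ 2)) * ennexp (θ * (e a) ^ 2) := by
      intro e; rw [← ennexp_add]; congr 1; ring
    simp_rw [h0]
    rw [lintegral_const_mul _ (by fun_prop)]
    have h1 := (measurePreserving_eval (fun _ : ι => g) a).lintegral_comp
      (f := fun x => ennexp (θ * x ^ 2)) (by fun_prop)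
    simp only [Function.eval] at h1
    rw [h1]
    calc _ ≤ ennexp (-(θ * σ ^ 2)) * ennexp (θ * σ ^ 2 + 4 * (θ * σ ^ 2) ^ 2) := by
          gcongr
          refine lintegral_ennexp_mul_sq_gaussianReal_le hσ ?_
          rw [mul_assoc, abs_mul, abs_two]; linarith
      _ = _ := by rw [← ennexp_add]; congr 1; ring
  · simp only [hab, if_false, sub_zero]
    have hind : IndepFun (fun e : ι → ℝ => e a) (fun e => e b) (noiseLaw ι σ) :=
      (iIndepFun_pi (μ := fun _ : ι => g) (X := fun _ x => x)
        (fun _ => aemeasurable_id)).indepFun hab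
    rw [indepFun_iff_map_prod_eq_prod_map_map (measurable_pi_apply a).aemeasurable
      (measurable_pi_apply b).aemeasurable] at hind
    have hm : ∀ c : ι, (noiseLaw ι σ).map (fun e => e c) = g := fun c =>
      (measurePreserving_eval (fun _ : ι => g) c).map_eq
    rw [hm, hm] at hind
    have h1 : ∫⁻ e, ennexp (θ * (e a * e b)) ∂(noiseLaw ι σ) =
        ∫⁻ z : ℝ × ℝ, ennexp (θ * (z.1 * z.2)) ∂(g.prod g) := by
      rw [← hind, lintegral_map (by fun_prop) (by fun_prop)]
    rw [h1, lintegral_prod _ (by fun_prop)]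
    have h2 : ∀ x : ℝ, ∫⁻ y, ennexp (θ * (x * y)) ∂g = ennexp ((σ ^ 2 * θ ^ 2 / 2) * x ^ 2) := by
      intro x
      simp_rw [← mul_assoc]
      rw [lintegral_ennexp_mul_gaussianReal]
      congr 1; ring
    simp_rw [h2]
    set w := θ * σ ^ 2 with hw
    obtain ⟨hw1, hw2⟩ := abs_le.1 h
    have hw3 : w ^ 2 ≤ 1 / 16 := by nlinarith
    have h3 : σ ^ 2 * θ ^ 2 / 2 * σ ^ 2 = w ^ 2 / 2 := by rw [hw]; ring
    refine (lintegral_ennexp_mul_sq_gaussianReal_le hσ ?_).trans (ennexp_mono ?_)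
    · rw [mul_assoc, h3, abs_of_nonneg (by positivity)]; linarith
    · rw [h3]; nlinarith [sq_nonneg w]

/-! ### Conditioning on the past of the process -/

section VAR

variable {ι : Type*} [Fintype ι] {Ω : Type*} [MeasurableSpace Ω]

/-- The path of `W` before time `t`, extended by zero from time `t` on. -/
noncomputable def past (W : ℤ → Ω → ι → ℝ) (t : ℤ) (ω : Ω) : ℤ → ι → ℝ :=
  fun s => if s < t then W s ω else 0

lemma past_of_lt (W : ℤ → Ω → ι → ℝ) {s t : ℤ} (h : s < t) (ω : Ω) : past W t ω s = W s ω :=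
  if_pos h

variable {μ : Measure Ω} [IsProbabilityMeasure μ] {B : Matrix ι ι ℝ} {σ : ℝ}
  {W ε : ℤ → Ω → ι → ℝ}

namespace IsStationaryVAR

lemma measurable_past (h : IsStationaryVAR μ B σ W ε) (t : ℤ) : Measurable (past W t) := by
  refine measurable_pi_lambda _ fun s => ?_
  by_cases hs : s < t
  · simp only [past, hs, if_true]; exact h.measurable_W s
  · simp only [past, hs, if_false]; exact measurable_const

lemma indepFun_past (h : IsStationaryVAR μ B σ W ε) (t : ℤ) : IndepFun (past W t) (ε t) μ := by
  let r : (Set.Iio t → ι → ℝ) → ℤ → ι → ℝ := fun w s => if hs : s < t then w ⟨s, hs⟩ else 0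
  have hr : Measurable r := by
    refine measurable_pi_lambda _ fun s => ?_
    by_cases hs : s < t
    · simp only [r, hs, dif_pos]; exact measurable_pi_apply _
    · simp only [r, hs, dif_neg, not_false_eq_true]; exact measurable_const
  have := (h.innovation t).symm.comp hr measurable_id
  convert! this using 2 with ω

/-- Given the past, the innovation is integrated against its law. -/
lemma lintegral_past_noise (h : IsStationaryVAR μ B σ W ε) (t : ℤ)
    {f : (ℤ → ι → ℝ) × (ι → ℝ) → ENNReal} (hf : Measurable f) :
    ∫⁻ ω, f (past W t ω, ε t ω) ∂μ = ∫⁻ ω, ∫⁻ e, f (past W t ω, e) ∂(noiseLaw ι σ) ∂μ := by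
  have hp := h.measurable_past t
  have he := h.measurable_noise t
  have hind := h.indepFun_past t
  rw [indepFun_iff_map_prod_eq_prod_map_map hp.aemeasurable he.aemeasurable, h.noise_law t] at hind
  rw [← lintegral_map hf (hp.prodMk he), hind, lintegral_prod _ hf.aemeasurable,
    lintegral_map hf.lintegral_prod_right' hp]

lemma noise_eq (h : IsStationaryVAR μ B σ W ε) :
    ∀ᵐ ω ∂μ, ∀ t, W t ω = B.mulVec (W (t - 1) ω) + ε t ω :=
  ae_all_iff.2 h.recursion

/-- Multiplying factors whose conditional expectation given the past is at most one produces a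
supermartingale. -/
lemma lintegral_prod_le_one (h : IsStationaryVAR μ B σ W ε) (τ : ℤ)
    {φ : ℕ → (ι → ℝ) → (ι → ℝ) → ENNReal} (hφ : ∀ k, Measurable (Function.uncurry (φ k)))
    (h1 : ∀ k w, ∫⁻ e, φ k w e ∂(noiseLaw ι σ) ≤ 1) (n : ℕ) :
    ∫⁻ ω, ∏ k ∈ Finset.range n, φ k (W (τ + k) ω) (ε (τ + k + 1) ω) ∂μ ≤ 1 := by
  induction n with
  | zero => simp
  | succ n ih =>
    let G : (ℤ → ι → ℝ) → ENNReal := fun w => ∏ k ∈ Finset.range n,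
      φ k (w (τ + k)) (w (τ + k + 1) - B.mulVec (w (τ + k)))
    have hG : Measurable G := by
      refine Finset.measurable_prod _ fun k _ => ?_
      have hB : Measurable fun w : ι → ℝ => B.mulVec w :=
        (Continuous.matrix_mulVec continuous_const continuous_id).measurable
      have : Measurable fun w : ℤ → ι → ℝ =>
          (w (τ + k), w (τ + k + 1) - B.mulVec (w (τ + k))) :=
        (measurable_pi_apply _).prodMk
          ((measurable_pi_apply _).sub (hB.comp (measurable_pi_apply _)))
      exact (hφ k).comp this
    have hGW : ∀ᵐ ω ∂μ, G (past W (τ + n + 1) ω) =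
        ∏ k ∈ Finset.range n, φ k (W (τ + k) ω) (ε (τ + k + 1) ω) := by
      filter_upwards [h.noise_eq] with ω hω
      refine Finset.prod_congr rfl fun k hk => ?_
      have hk' := Finset.mem_range.1 hk
      rw [past_of_lt W (by omega), past_of_lt W (by omega), hω (τ + k + 1)]
      congr 1
      rw [add_sub_cancel_right, add_sub_cancel_left]
    have hmeas : Measurable fun z : (ℤ → ι → ℝ) × (ι → ℝ) => φ n (z.1 (τ + n)) z.2 :=
      (hφ n).comp (g := Function.uncurry (φ n))
        (f := fun z : (ℤ → ι → ℝ) × (ι → ℝ) => (z.1 (τ + n), z.2))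
        (((measurable_pi_apply _).comp measurable_fst).prodMk measurable_snd)
    calc ∫⁻ ω, ∏ k ∈ Finset.range (n + 1), φ k (W (τ + k) ω) (ε (τ + k + 1) ω) ∂μ
        = ∫⁻ ω, G (past W (τ + n + 1) ω) *
            φ n (past W (τ + n + 1) ω (τ + n)) (ε (τ + n + 1) ω) ∂μ := by
          refine lintegral_congr_ae ?_
          filter_upwards [hGW] with ω hω
          rw [Finset.prod_range_succ, hω, past_of_lt W (by omega)]
      _ = ∫⁻ ω, ∫⁻ e, G (past W (τ + n + 1) ω) *
            φ n (past W (τ + n + 1) ω (τ + n)) e ∂(noiseLaw ι σ) ∂μ :=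
          h.lintegral_past_noise (τ + n + 1) (f := fun z => G z.1 * φ n (z.1 (τ + n)) z.2)
            ((hG.comp measurable_fst).mul hmeas)
      _ ≤ ∫⁻ ω, G (past W (τ + n + 1) ω) ∂μ := by
          refine lintegral_mono fun ω => ?_
          have hm : Measurable (φ n (past W (τ + n + 1) ω (τ + n))) :=
            (hφ n).comp measurable_prodMk_left
          rw [lintegral_const_mul _ hm]
          exact mul_le_of_le_one_right' (h1 n _)
      _ = ∫⁻ ω, ∏ k ∈ Finset.range n, φ k (W (τ + k) ω) (ε (τ + k + 1) ω) ∂μ :=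
          lintegral_congr_ae hGW
      _ ≤ 1 := ih

lemma measurable_dotProduct (h : IsStationaryVAR μ B σ W ε) (c : ι → ℝ) (t : ℤ) :
    Measurable fun ω => c ⬝ᵥ W t ω :=
  Finset.measurable_fun_sum _ fun a _ =>
    ((measurable_pi_apply a).comp (h.measurable_W t)).const_mul _

lemma memLp_dotProduct (h : IsStationaryVAR μ B σ W ε) (c : ι → ℝ) (t : ℤ) :
    MemLp (fun ω => c ⬝ᵥ W t ω) 2 μ :=
  memLp_finsetSum _ fun a _ => (h.memLp t a).const_mul _

lemma dotProduct_recursion (h : IsStationaryVAR μ B σ W ε) (c : ι → ℝ) (t : ℤ) :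
    ∀ᵐ ω ∂μ, c ⬝ᵥ W t ω = Matrix.vecMul c B ⬝ᵥ W (t - 1) ω + c ⬝ᵥ ε t ω := by
  filter_upwards [h.recursion t] with ω hω
  conv_lhs => rw [hω]
  rw [dotProduct_add, Matrix.dotProduct_mulVec]

lemma memLp_noise_coord (σ : ℝ) (c : ι → ℝ) (a : ι) :
    MemLp (fun x : ℝ => c a * x) 2 (gaussianReal 0 (σ ^ 2).toNNReal) :=
  (memLp_id_gaussianReal 2).const_mul _

lemma measurePreserving_noise (h : IsStationaryVAR μ B σ W ε) (t : ℤ) :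
    MeasurePreserving (ε t) μ (noiseLaw ι σ) := ⟨h.measurable_noise t, h.noise_law t⟩

lemma memLp_noise (h : IsStationaryVAR μ B σ W ε) (c : ι → ℝ) (t : ℤ) :
    MemLp (fun ω => c ⬝ᵥ ε t ω) 2 μ := by
  refine memLp_finsetSum _ fun a _ => ?_
  have h1 := (memLp_noise_coord σ c a).comp_measurePreserving
    (measurePreserving_eval (fun _ : ι => gaussianReal 0 (σ ^ 2).toNNReal) a)
  exact h1.comp_measurePreserving (h.measurePreserving_noise t)

lemma variance_noise (h : IsStationaryVAR μ B σ W ε) (c : ι → ℝ) (t : ℤ) :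
    Var[fun ω => c ⬝ᵥ ε t ω; μ] = σ ^ 2 * ∑ a, c a ^ 2 := by
  have hmp := h.measurePreserving_noise t
  have h0 : Measurable fun e : ι → ℝ => c ⬝ᵥ e :=
    Finset.measurable_fun_sum _ fun a _ => (measurable_pi_apply a).const_mul _
  have h1 := variance_map (X := fun e : ι → ℝ => c ⬝ᵥ e) (μ := μ) (Y := ε t)
    h0.aemeasurable hmp.measurable.aemeasurable
  have h2 := variance_sum_pi (X := fun a (x : ℝ) => c a * x) (memLp_noise_coord σ c)
  rw [hmp.map_eq] at h1
  change _ = Var[fun ω => c ⬝ᵥ ε t ω; μ] at h1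
  rw [← h1]
  have h3 : (∑ a, fun e : ι → ℝ => c a * e a) = fun e => c ⬝ᵥ e := by
    ext e; simp [dotProduct]
  rw [h3] at h2
  rw [noiseLaw, h2, Finset.mul_sum]
  refine Finset.sum_congr rfl fun a _ => ?_
  rw [variance_const_mul, variance_fun_id_gaussianReal, Real.coe_toNNReal _ (sq_nonneg σ)]
  ring

lemma integral_noise (h : IsStationaryVAR μ B σ W ε) (t : ℤ) (a : ι) :
    ∫ ω, ε t ω a ∂μ = 0 := by
  have h1 := (measurePreserving_eval (fun _ : ι => gaussianReal 0 (σ ^ 2).toNNReal) a).comp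
    (h.measurePreserving_noise t)
  have h2 := integral_id_gaussianReal (μ := 0) (v := (σ ^ 2).toNNReal)
  rw [← h1.map_eq, integral_map h1.measurable.aemeasurable (by fun_prop)] at h2
  exact h2

/-- A function of the past is uncorrelated with the innovation. -/
lemma variance_past_add_noise (h : IsStationaryVAR μ B σ W ε) (t : ℤ) {G : (ℤ → ι → ℝ) → ℝ}
    (hG : Measurable G) (hG2 : MemLp (fun ω => G (past W t ω)) 2 μ) (c : ι → ℝ) :
    Var[fun ω => G (past W t ω) + c ⬝ᵥ ε t ω; μ] =
      Var[fun ω => G (past W t ω); μ] + σ ^ 2 * ∑ a, c a ^ 2 := by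
  have h0 : Measurable fun e : ι → ℝ => c ⬝ᵥ e :=
    Finset.measurable_fun_sum _ fun a _ => (measurable_pi_apply a).const_mul _
  have := IndepFun.variance_fun_add hG2 (h.memLp_noise c t) ((h.indepFun_past t).comp hG h0)
  rw [this, h.variance_noise]

lemma lintegral_ennexp_past_add_noise (h : IsStationaryVAR μ B σ W ε) (t : ℤ)
    {G : (ℤ → ι → ℝ) → ℝ} (hG : Measurable G) (c : ι → ℝ) :
    ∫⁻ ω, ennexp (G (past W t ω) + c ⬝ᵥ ε t ω) ∂μ =
      (∫⁻ ω, ennexp (G (past W t ω)) ∂μ) * ennexp (σ ^ 2 * (∑ a, c a ^ 2) / 2) := by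
  have h0 : Measurable fun e : ι → ℝ => c ⬝ᵥ e :=
    Finset.measurable_fun_sum _ fun a _ => (measurable_pi_apply a).const_mul _
  have hm : Measurable fun z : (ℤ → ι → ℝ) × (ι → ℝ) => ennexp (G z.1 + c ⬝ᵥ z.2) :=
    measurable_ennexp.comp ((hG.comp measurable_fst).add (h0.comp measurable_snd))
  have := h.lintegral_past_noise t hm
  simp only at this
  have hGm : Measurable fun ω => ennexp (G (past W t ω)) :=
    measurable_ennexp.comp (hG.comp (h.measurable_past t))
  rw [this, ← lintegral_mul_const _ hGm]
  refine lintegral_congr fun ω => ?_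
  simp_rw [ennexp_add]
  have hem : Measurable fun e : ι → ℝ => ennexp (c ⬝ᵥ e) := measurable_ennexp.comp h0
  rw [lintegral_const_mul _ hem]
  congr 1
  exact lintegral_ennexp_noiseLaw σ c

end IsStationaryVAR

end VAR

/-! ### Linear functionals of the process are sub-Gaussian -/

section VAR

open Filter Topology

variable {ι : Type*} [Fintype ι] {Ω : Type*} [MeasurableSpace Ω]
variable {μ : Measure Ω} [IsProbabilityMeasure μ] {B : Matrix ι ι ℝ} {σ : ℝ}
  {W ε : ℤ → Ω → ι → ℝ}

/-- The row vector `c Bᵏ`: the weight that `c ⬝ᵥ W_t` puts on `W_{t-k}` once the recursion has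
been unrolled `k` times. -/
def rowIter (B : Matrix ι ι ℝ) (c : ι → ℝ) (k : ℕ) : ι → ℝ :=
  (fun c => Matrix.vecMul c B)^[k] c

lemma rowIter_succ (B : Matrix ι ι ℝ) (c : ι → ℝ) (k : ℕ) :
    rowIter B c (k + 1) = rowIter B (Matrix.vecMul c B) k := rfl

lemma rowIter_succ' (B : Matrix ι ι ℝ) (c : ι → ℝ) (k : ℕ) :
    rowIter B c (k + 1) = Matrix.vecMul (rowIter B c k) B :=
  Function.iterate_succ_apply' _ _ _

namespace IsStationaryVAR

lemma variance_dotProduct (h : IsStationaryVAR μ B σ W ε) (c : ι → ℝ) (t : ℤ) :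
    Var[fun ω => c ⬝ᵥ W t ω; μ] = ∑ a, ∑ b, c a * (c b * autocov μ W 0 a b) := by
  unfold dotProduct
  rw [variance_fun_sum fun a => (h.memLp t a).const_mul _]
  refine Finset.sum_congr rfl fun a _ => Finset.sum_congr rfl fun b _ => ?_
  have := h.cov_eq t 0 a b
  rw [add_zero] at this
  rw [covariance_const_mul_left, covariance_const_mul_right, this]
  rfl

/-- The variance of a linear functional of the process does not depend on time. -/
lemma variance_dotProduct_eq (h : IsStationaryVAR μ B σ W ε) (c : ι → ℝ) (t s : ℤ) :
    Var[fun ω => c ⬝ᵥ W t ω; μ] = Var[fun ω => c ⬝ᵥ W s ω; μ] := by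
  rw [h.variance_dotProduct, h.variance_dotProduct]

lemma measurable_dotProduct_path (c : ι → ℝ) (s : ℤ) :
    Measurable fun w : ℤ → ι → ℝ => c ⬝ᵥ w s :=
  Finset.measurable_fun_sum _ fun a _ => by
    have : Measurable fun w : ℤ → ι → ℝ => w s a :=
      (measurable_pi_apply a).comp (measurable_pi_apply s)
    exact this.const_mul _

/-- The Lyapunov equation `V(c) = V(c B) + σ² ‖c‖²` for `V(c) = Var (c ⬝ᵥ W_t)`. -/
lemma variance_recursion (h : IsStationaryVAR μ B σ W ε) (c : ι → ℝ) (t s : ℤ) :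
    Var[fun ω => c ⬝ᵥ W t ω; μ] =
      Var[fun ω => Matrix.vecMul c B ⬝ᵥ W s ω; μ] + σ ^ 2 * ∑ a, c a ^ 2 := by
  have h2 : ∀ ω, past W t ω (t - 1) = W (t - 1) ω := fun ω => past_of_lt W (by omega) ω
  have h1 := h.variance_past_add_noise t (G := fun w => Matrix.vecMul c B ⬝ᵥ w (t - 1))
    (measurable_dotProduct_path _ _) (by simpa only [h2] using h.memLp_dotProduct _ (t - 1)) c
  simp only [h2] at h1
  rw [variance_congr (h.dotProduct_recursion c t), h1, h.variance_dotProduct_eq _ (t - 1) s]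

lemma sum_rowIter_le (h : IsStationaryVAR μ B σ W ε) (c : ι → ℝ) (n : ℕ) :
    ∑ k ∈ Finset.range n, σ ^ 2 * ∑ a, rowIter B c k a ^ 2 ≤ Var[fun ω => c ⬝ᵥ W 0 ω; μ] := by
  suffices H : Var[fun ω => c ⬝ᵥ W 0 ω; μ] = Var[fun ω => rowIter B c n ⬝ᵥ W 0 ω; μ] +
      ∑ k ∈ Finset.range n, σ ^ 2 * ∑ a, rowIter B c k a ^ 2 by
    rw [H]; linarith [variance_nonneg (fun ω => rowIter B c n ⬝ᵥ W 0 ω) μ]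
  induction n with
  | zero => simp [rowIter]
  | succ n ih =>
    rw [ih, Finset.sum_range_succ, rowIter_succ',
      h.variance_recursion (rowIter B c n) 0 0]
    ring

/-- Stationarity with nondegenerate innovations forces `c Bᵏ → 0`: the innovations that enter
`c ⬝ᵥ W_0` have total variance at most `Var (c ⬝ᵥ W_0)`. -/
lemma tendsto_rowIter (h : IsStationaryVAR μ B σ W ε) (hσ : 0 < σ) (c : ι → ℝ) (a : ι) :
    Tendsto (fun k => rowIter B c k a) atTop (𝓝 0) := by
  have hs : Summable fun k => σ ^ 2 * ∑ a, rowIter B c k a ^ 2 :=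
    summable_of_sum_range_le (fun k => by positivity) (h.sum_rowIter_le c)
  have h0 := hs.tendsto_atTop_zero
  have h1 : Tendsto (fun k => σ ^ 2 * (rowIter B c k a) ^ 2) atTop (𝓝 0) := by
    refine squeeze_zero (fun k => by positivity) (fun k => ?_) h0
    gcongr
    exact Finset.single_le_sum (f := fun a => rowIter B c k a ^ 2)
      (fun a _ => sq_nonneg _) (Finset.mem_univ a)
  have h2 : Tendsto (fun k => (rowIter B c k a) ^ 2) atTop (𝓝 0) := by
    have := h1.const_mul (σ ^ 2)⁻¹
    simpa [← mul_assoc, inv_mul_cancel₀ (pow_pos hσ 2).ne'] using this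
  simpa [Real.sqrt_sq_eq_abs, tendsto_zero_iff_abs_tendsto_zero, Function.comp_def]
    using (Real.continuous_sqrt.tendsto 0).comp h2

lemma integral_dotProduct (h : IsStationaryVAR μ B σ W ε) (c : ι → ℝ) (t : ℤ) :
    ∫ ω, c ⬝ᵥ W t ω ∂μ = ∑ a, c a * ∫ ω, W 0 ω a ∂μ := by
  unfold dotProduct
  rw [integral_finsetSum _ fun a _ => ((h.memLp t a).integrable one_le_two).const_mul _]
  simp_rw [integral_const_mul, h.mean_eq t]

/-- A stationary VAR process is centred. -/
lemma integral_dotProduct_eq_zero (h : IsStationaryVAR μ B σ W ε) (hσ : 0 < σ) (c : ι → ℝ)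
    (t : ℤ) : ∫ ω, c ⬝ᵥ W t ω ∂μ = 0 := by
  have hstep : ∀ c : ι → ℝ,
      ∫ ω, c ⬝ᵥ W 0 ω ∂μ = ∫ ω, Matrix.vecMul c B ⬝ᵥ W 0 ω ∂μ := by
    intro c
    have hn : ∫ ω, c ⬝ᵥ ε 0 ω ∂μ = 0 := by
      unfold dotProduct
      have hint : ∀ a, Integrable (fun ω => c a * ε 0 ω a) μ := fun a => by
        classical
        have := (h.memLp_noise (Pi.single a 1) 0).integrable one_le_two
        simp only [single_one_dotProduct] at this
        exact this.const_mul _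
      rw [integral_finsetSum _ fun a _ => hint a]
      simp [integral_const_mul, h.integral_noise]
    rw [integral_congr_ae (h.dotProduct_recursion c 0),
      integral_add ((h.memLp_dotProduct _ _).integrable one_le_two)
        ((h.memLp_noise c 0).integrable one_le_two), hn, add_zero,
      h.integral_dotProduct, h.integral_dotProduct]
  have hk : ∀ k, ∫ ω, c ⬝ᵥ W 0 ω ∂μ = ∑ a, rowIter B c k a * ∫ ω, W 0 ω a ∂μ := by
    intro k
    rw [← h.integral_dotProduct _ 0]
    induction k with
    | zero => rfl
    | succ k ih => rw [ih, rowIter_succ', hstep]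
  have hlim : Tendsto (fun k => ∑ a, rowIter B c k a * ∫ ω, W 0 ω a ∂μ) atTop (𝓝 0) := by
    have := tendsto_finsetSum (f := fun a k => rowIter B c k a * ∫ ω, W 0 ω a ∂μ) Finset.univ
      (fun a _ => (h.tendsto_rowIter hσ c a).mul_const _)
    simpa using this
  have h0 : ∫ ω, c ⬝ᵥ W 0 ω ∂μ = 0 := by
    refine tendsto_nhds_unique ?_ hlim
    simp_rw [← hk]
    exact tendsto_const_nhds
  rw [h.integral_dotProduct, ← h.integral_dotProduct c 0, h0]

lemma tendsto_variance_rowIter (h : IsStationaryVAR μ B σ W ε) (hσ : 0 < σ) (c : ι → ℝ) :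
    Tendsto (fun k => Var[fun ω => rowIter B c k ⬝ᵥ W 0 ω; μ]) atTop (𝓝 0) := by
  simp_rw [h.variance_dotProduct]
  have : Tendsto (fun k => ∑ a, ∑ b, rowIter B c k a * (rowIter B c k b * autocov μ W 0 a b))
      atTop (𝓝 (∑ a : ι, ∑ b : ι, 0 * (0 * autocov μ W 0 a b))) :=
    tendsto_finsetSum _ fun a _ => tendsto_finsetSum _ fun b _ =>
      (h.tendsto_rowIter hσ c a).mul ((h.tendsto_rowIter hσ c b).mul_const _)
  simpa using this

lemma lintegral_ennexp_sub_rowIter_le (h : IsStationaryVAR μ B σ W ε) (k : ℕ) :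
    ∀ (c : ι → ℝ) (t : ℤ),
      ∫⁻ ω, ennexp (c ⬝ᵥ W t ω - rowIter B c k ⬝ᵥ W (t - k) ω) ∂μ ≤
        ennexp (Var[fun ω => c ⬝ᵥ W 0 ω; μ] / 2) := by
  induction k with
  | zero =>
    intro c t
    simpa [rowIter, ennexp_zero] using
      ennexp_mono (div_nonneg (variance_nonneg (fun ω => c ⬝ᵥ W 0 ω) μ) zero_le_two)
  | succ k ih =>
    intro c t
    set c' := Matrix.vecMul c B
    let G : (ℤ → ι → ℝ) → ℝ := fun w => c' ⬝ᵥ w (t - 1) - rowIter B c' k ⬝ᵥ w (t - 1 - k)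
    have hG : Measurable G :=
      (measurable_dotProduct_path _ _).sub (measurable_dotProduct_path _ _)
    have hGW : ∀ ω, G (past W t ω) = c' ⬝ᵥ W (t - 1) ω - rowIter B c' k ⬝ᵥ W (t - 1 - k) ω := by
      intro ω
      simp only [G]
      rw [past_of_lt W (by omega), past_of_lt W (by omega)]
    have hcongr : ∀ᵐ ω ∂μ, ennexp (c ⬝ᵥ W t ω - rowIter B c (k + 1) ⬝ᵥ W (t - (k + 1 : ℕ)) ω) =
        ennexp (G (past W t ω) + c ⬝ᵥ ε t ω) := by
      filter_upwards [h.dotProduct_recursion c t] with ω hω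
      rw [hGW, hω, rowIter_succ, show t - ((k + 1 : ℕ) : ℤ) = t - 1 - k by push_cast; ring]
      congr 1
      ring
    rw [lintegral_congr_ae hcongr, h.lintegral_ennexp_past_add_noise t hG,
      h.variance_recursion c 0 0, add_div, ennexp_add]
    gcongr
    simp_rw [hGW]
    exact ih c' (t - 1)

/-- One-time linear functionals are sub-Gaussian. Unrolling the recursion writes `c ⬝ᵥ W_t` as a
sum of independent Gaussian variables plus `c Bᵏ ⬝ᵥ W_{t-k}`; the remainder tends to zero in
probability, and Fatou's lemma passes to the limit. -/
lemma lintegral_ennexp_dotProduct_le (h : IsStationaryVAR μ B σ W ε) (hσ : 0 < σ) (c : ι → ℝ)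
    (t : ℤ) :
    ∫⁻ ω, ennexp (c ⬝ᵥ W t ω) ∂μ ≤ ennexp (Var[fun ω => c ⬝ᵥ W 0 ω; μ] / 2) := by
  have hmeas : TendstoInMeasure μ (fun (k : ℕ) ω => rowIter B c k ⬝ᵥ W (t - k) ω) atTop
      (fun _ => (0 : ℝ)) := by
    rw [tendstoInMeasure_iff_dist]
    intro δ hδ
    have hb : ∀ k : ℕ, μ {ω | δ ≤ dist (rowIter B c k ⬝ᵥ W (t - k) ω) 0} ≤
        ENNReal.ofReal (Var[fun ω => rowIter B c k ⬝ᵥ W 0 ω; μ] / δ ^ 2) := by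
      intro k
      have := meas_ge_le_variance_div_sq (h.memLp_dotProduct (rowIter B c k) (t - k)) hδ
      rw [h.integral_dotProduct_eq_zero hσ, h.variance_dotProduct_eq _ (t - k) 0] at this
      simpa [Real.dist_eq] using this
    have hl : Tendsto (fun k : ℕ =>
        ENNReal.ofReal (Var[fun ω => rowIter B c k ⬝ᵥ W 0 ω; μ] / δ ^ 2)) atTop (𝓝 0) := by
      have := ENNReal.tendsto_ofReal ((h.tendsto_variance_rowIter hσ c).div_const (δ ^ 2))
      simpa using this
    exact tendsto_of_tendsto_of_tendsto_of_le_of_le tendsto_const_nhds hl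
      (fun _ => zero_le) hb
  obtain ⟨ns, -, hns⟩ := hmeas.exists_seq_tendsto_ae
  calc ∫⁻ ω, ennexp (c ⬝ᵥ W t ω) ∂μ
      = ∫⁻ ω, liminf (fun i => ennexp (c ⬝ᵥ W t ω - rowIter B c (ns i) ⬝ᵥ W (t - ns i) ω))
          atTop ∂μ := by
        refine lintegral_congr_ae ?_
        filter_upwards [hns] with ω hω
        have h1 := hω.const_sub (c ⬝ᵥ W t ω)
        rw [sub_zero] at h1
        exact ((continuous_ennexp.tendsto _).comp h1).liminf_eq.symm
    _ ≤ liminf (fun i => ∫⁻ ω, ennexp (c ⬝ᵥ W t ω - rowIter B c (ns i) ⬝ᵥ W (t - ns i) ω) ∂μ)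
          atTop :=
        lintegral_liminf_le fun i => measurable_ennexp.comp
          ((h.measurable_dotProduct _ _).sub (h.measurable_dotProduct _ _))
    _ ≤ ennexp (Var[fun ω => c ⬝ᵥ W 0 ω; μ] / 2) := by
        refine (liminf_le_liminf (Eventually.of_forall fun i =>
          h.lintegral_ennexp_sub_rowIter_le (ns i) c t)).trans ?_
        rw [liminf_const]

/-- Linear functionals of a finite stretch of the process are sub-Gaussian with their variance as
variance proxy. -/
lemma lintegral_ennexp_sum_dotProduct_le (h : IsStationaryVAR μ B σ W ε) (hσ : 0 < σ) (τ : ℤ)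
    (n : ℕ) : ∀ y : ℕ → ι → ℝ,
      ∫⁻ ω, ennexp (∑ k ∈ Finset.range (n + 1), y k ⬝ᵥ W (τ + k) ω) ∂μ ≤
        ennexp (Var[fun ω => ∑ k ∈ Finset.range (n + 1), y k ⬝ᵥ W (τ + k) ω; μ] / 2) := by
  induction n with
  | zero =>
    intro y
    simp only [zero_add, Finset.sum_range_one, Nat.cast_zero, add_zero]
    rw [h.variance_dotProduct_eq _ τ 0]
    exact h.lintegral_ennexp_dotProduct_le hσ _ _
  | succ n ih =>
    intro y
    set c := y (n + 1) with hc
    set t : ℤ := τ + (n + 1 : ℕ) with ht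
    set y' : ℕ → ι → ℝ := Function.update y n (y n + Matrix.vecMul c B) with hy'
    let G : (ℤ → ι → ℝ) → ℝ := fun w => ∑ k ∈ Finset.range (n + 1), y' k ⬝ᵥ w (τ + k)
    have hG : Measurable G := Finset.measurable_fun_sum _ fun k _ => measurable_dotProduct_path _ _
    have hGW : ∀ ω, G (past W t ω) = ∑ k ∈ Finset.range (n + 1), y' k ⬝ᵥ W (τ + k) ω := by
      intro ω
      refine Finset.sum_congr rfl fun k hk => ?_
      rw [past_of_lt W]
      have := Finset.mem_range.1 hk
      omega
    have hsum : ∀ᵐ ω ∂μ, ∑ k ∈ Finset.range (n + 1 + 1), y k ⬝ᵥ W (τ + k) ω =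
        G (past W t ω) + c ⬝ᵥ ε t ω := by
      filter_upwards [h.dotProduct_recursion c t] with ω hω
      rw [hGW, Finset.sum_range_succ, ← hc, ← ht, hω, Finset.sum_range_succ,
        Finset.sum_range_succ _ n]
      have h1 : ∑ k ∈ Finset.range n, y' k ⬝ᵥ W (τ + k) ω =
          ∑ k ∈ Finset.range n, y k ⬝ᵥ W (τ + k) ω := by
        refine Finset.sum_congr rfl fun k hk => ?_
        rw [hy', Function.update_of_ne (Finset.mem_range.1 hk).ne]
      rw [h1, hy', Function.update_self, add_dotProduct,
        show t - 1 = τ + n by rw [ht]; push_cast; ring]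
      ring
    have hmem : MemLp (fun ω => G (past W t ω)) 2 μ := by
      simp_rw [hGW]
      exact memLp_finsetSum _ fun k _ => h.memLp_dotProduct _ _
    rw [variance_congr hsum, h.variance_past_add_noise t hG hmem, add_div, ennexp_add,
      lintegral_congr_ae (hsum.mono fun ω hω => by rw [hω]),
      h.lintegral_ennexp_past_add_noise t hG]
    gcongr
    simp_rw [hGW]
    exact ih y'

end IsStationaryVAR

end VAR

/-! ### Variance bounds from the spectral density -/

lemma integral_cos_int_mul (n : ℤ) :
    ∫ θ in (-π)..π, Real.cos (n * θ) = if n = 0 then 2 * π else 0 := by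
  split_ifs with h
  · subst h; simp; ring
  · have hn : (n : ℝ) ≠ 0 := by exact_mod_cast h
    rw [intervalIntegral.integral_comp_mul_left Real.cos hn, integral_cos]
    have : Real.sin (n * π) = 0 := Real.sin_int_mul_pi n
    simp [this]

lemma integral_cos_mul_cos (l m : ℤ) :
    ∫ θ in (-π)..π, Real.cos (l * θ) * Real.cos (m * θ) =
      (if l = m then π else 0) + (if l = -m then π else 0) := by
  have h : ∀ θ : ℝ, Real.cos (l * θ) * Real.cos (m * θ) =
      (1 / 2) * Real.cos ((l - m : ℤ) * θ) + (1 / 2) * Real.cos ((l + m : ℤ) * θ) := by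
    intro θ
    push_cast
    rw [sub_mul, add_mul, Real.cos_sub, Real.cos_add]; ring
  simp_rw [h]
  rw [intervalIntegral.integral_add (Continuous.intervalIntegrable (by fun_prop) _ _)
      (Continuous.intervalIntegrable (by fun_prop) _ _),
    intervalIntegral.integral_const_mul, intervalIntegral.integral_const_mul,
    integral_cos_int_mul, integral_cos_int_mul]
  simp only [sub_eq_zero, add_eq_zero_iff_eq_neg]
  split_ifs <;> ring

lemma summable_mul_cos {γ : ℤ → ℝ} (hγ : Summable γ) (θ : ℝ) :
    Summable fun l : ℤ => γ l * Real.cos (l * θ) := by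
  refine Summable.of_norm_bounded hγ.abs fun l => ?_
  rw [Real.norm_eq_abs, abs_mul]
  exact mul_le_of_le_one_right (abs_nonneg _) (Real.abs_cos_le_one _)

lemma continuous_tsum_mul_cos {γ : ℤ → ℝ} (hγ : Summable γ) :
    Continuous fun θ : ℝ => ∑' l : ℤ, γ l * Real.cos (l * θ) := by
  refine continuous_tsum (fun l => by fun_prop) hγ.abs fun l θ => ?_
  rw [Real.norm_eq_abs, abs_mul]
  exact mul_le_of_le_one_right (abs_nonneg _) (Real.abs_cos_le_one _)

/-- The cosine coefficients of `∑ γ_l cos (l θ)`. -/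
lemma integral_tsum_mul_cos {γ : ℤ → ℝ} (hγ : Summable γ) (m : ℤ) :
    ∫ θ in (-π)..π, (∑' l : ℤ, γ l * Real.cos (l * θ)) * Real.cos (m * θ) =
      π * (γ m + γ (-m)) := by
  have h1 := intervalIntegral.hasSum_integral_of_dominated_convergence (μ := volume)
    (a := -π) (b := π) (F := fun (l : ℤ) θ => γ l * Real.cos (l * θ) * Real.cos (m * θ))
    (f := fun θ => (∑' l : ℤ, γ l * Real.cos (l * θ)) * Real.cos (m * θ))
    (fun l _ => |γ l|) (fun l => Continuous.aestronglyMeasurable (by fun_prop))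
    (fun l => Filter.Eventually.of_forall fun θ _ => by
      rw [Real.norm_eq_abs, abs_mul, abs_mul]
      exact (mul_le_of_le_one_right (by positivity) (Real.abs_cos_le_one _)).trans
        (mul_le_of_le_one_right (abs_nonneg _) (Real.abs_cos_le_one _)))
    (Filter.Eventually.of_forall fun θ _ => hγ.abs)
    (by simp)
    (Filter.Eventually.of_forall fun θ _ => (summable_mul_cos hγ θ).hasSum.mul_right _)
  have h2 : ∀ l : ℤ, ∫ θ in (-π)..π, γ l * Real.cos (l * θ) * Real.cos (m * θ) =
      (if l = m then π * γ l else 0) + (if l = -m then π * γ l else 0) := by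
    intro l
    simp_rw [mul_assoc]
    rw [intervalIntegral.integral_const_mul, integral_cos_mul_cos]
    split_ifs <;> ring
  simp_rw [h2] at h1
  have h3 := (hasSum_ite_eq m (π * γ m)).add (hasSum_ite_eq (-m) (π * γ (-m)))
  have h4 : (fun l : ℤ => (if l = m then π * γ l else 0) + (if l = -m then π * γ l else 0)) =
      fun l => (if l = m then π * γ m else 0) + (if l = -m then π * γ (-m) else 0) := by
    ext l
    congr 1 <;> split_ifs with hl <;> simp [hl]
  rw [h4] at h1
  rw [h1.unique h3]; ring

/-- The quadratic form of a Toeplitz matrix is at most the supremum of its symbol. -/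
lemma sum_sum_toeplitz_le {γ : ℤ → ℝ} (hγ : Summable γ) {M : ℝ}
    (hM : ∀ θ ∈ Set.Icc (-π) π, ∑' l : ℤ, γ l * Real.cos (l * θ) ≤ M) (x : ℕ → ℝ) (n : ℕ) :
    ∑ j ∈ Finset.range n, ∑ k ∈ Finset.range n, x j * x k * γ ((k : ℤ) - j) ≤
      M * ∑ k ∈ Finset.range n, x k ^ 2 := by
  set g : ℝ → ℝ := fun θ => ∑' l : ℤ, γ l * Real.cos (l * θ) with hg
  have hgc : Continuous g := continuous_tsum_mul_cos hγ
  -- `P` is the squared modulus of the trigonometric polynomial `∑ x_k exp (i k θ)`.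
  set P : ℝ → ℝ := fun θ => ∑ j ∈ Finset.range n, ∑ k ∈ Finset.range n,
    x j * x k * Real.cos (((k : ℤ) - j : ℤ) * θ) with hP
  have hPc : Continuous P := by fun_prop
  have hP0 : ∀ θ, 0 ≤ P θ := by
    intro θ
    have : P θ = (∑ k ∈ Finset.range n, x k * Real.cos (k * θ)) ^ 2 +
        (∑ k ∈ Finset.range n, x k * Real.sin (k * θ)) ^ 2 := by
      simp only [hP, sq, Finset.sum_mul_sum, ← Finset.sum_add_distrib]
      refine Finset.sum_congr rfl fun j _ => Finset.sum_congr rfl fun k _ => ?_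
      push_cast
      rw [sub_mul, Real.cos_sub]; ring
    rw [this]; positivity
  have hint : ∀ f : ℝ → ℝ, Continuous f → ∫ θ in (-π)..π, f θ * P θ =
      ∑ j ∈ Finset.range n, ∑ k ∈ Finset.range n,
        x j * x k * ∫ θ in (-π)..π, f θ * Real.cos (((k : ℤ) - j : ℤ) * θ) := by
    intro f hf
    simp only [hP, Finset.mul_sum]
    rw [intervalIntegral.integral_finsetSum fun j _ =>
      Continuous.intervalIntegrable (by fun_prop) _ _]
    refine Finset.sum_congr rfl fun j _ => ?_
    rw [intervalIntegral.integral_finsetSum fun j _ =>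
      Continuous.intervalIntegrable (by fun_prop) _ _]
    refine Finset.sum_congr rfl fun k _ => ?_
    rw [← intervalIntegral.integral_const_mul]
    congr 1; ext θ; ring
  have hmono : ∫ θ in (-π)..π, g θ * P θ ≤ ∫ θ in (-π)..π, M * P θ := by
    refine intervalIntegral.integral_mono_on (by linarith [Real.pi_pos])
      ((hgc.mul hPc).intervalIntegrable _ _)
      ((continuous_const.mul hPc).intervalIntegrable _ _) fun θ hθ => ?_
    exact mul_le_mul_of_nonneg_right (hM θ hθ) (hP0 θ)
  rw [hint g hgc, hint (fun _ => M) continuous_const] at hmono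
  have h1 : ∑ j ∈ Finset.range n, ∑ k ∈ Finset.range n,
      x j * x k * ∫ θ in (-π)..π, g θ * Real.cos (((k : ℤ) - j : ℤ) * θ) =
      2 * π * ∑ j ∈ Finset.range n, ∑ k ∈ Finset.range n, x j * x k * γ ((k : ℤ) - j) := by
    have hsw : ∑ j ∈ Finset.range n, ∑ k ∈ Finset.range n, x j * x k * γ (-((k : ℤ) - j)) =
        ∑ j ∈ Finset.range n, ∑ k ∈ Finset.range n, x j * x k * γ ((k : ℤ) - j) := by
      rw [Finset.sum_comm]
      refine Finset.sum_congr rfl fun j _ => Finset.sum_congr rfl fun k _ => ?_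
      rw [neg_sub]; ring
    rw [two_mul π, add_mul]
    nth_rewrite 2 [← hsw]
    simp only [Finset.mul_sum, ← Finset.sum_add_distrib]
    refine Finset.sum_congr rfl fun j _ => Finset.sum_congr rfl fun k _ => ?_
    rw [integral_tsum_mul_cos hγ]; ring
  have h2 : ∑ j ∈ Finset.range n, ∑ k ∈ Finset.range n,
      x j * x k * ∫ θ in (-π)..π, M * Real.cos (((k : ℤ) - j : ℤ) * θ) =
      2 * π * (M * ∑ k ∈ Finset.range n, x k ^ 2) := by
    simp only [Finset.mul_sum]
    refine Finset.sum_congr rfl fun j hj => ?_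
    rw [Finset.sum_eq_single j]
    · rw [intervalIntegral.integral_const_mul, integral_cos_int_mul, if_pos (sub_self _)]; ring
    · intro k _ hk
      rw [intervalIntegral.integral_const_mul, integral_cos_int_mul, if_neg (by omega)]; ring
    · intro h; exact absurd hj h
  rw [h1, h2] at hmono
  exact le_of_mul_le_mul_left hmono (by positivity)

section

variable {ι : Type*} [Fintype ι] [DecidableEq ι] {Ω : Type*} [MeasurableSpace Ω]
variable {μ : Measure Ω} [IsProbabilityMeasure μ] {B : Matrix ι ι ℝ} {σ lo hi : ℝ}
  {W ε : ℤ → Ω → ι → ℝ}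

lemma IsStationaryVAR.autocov_neg (h : IsStationaryVAR μ B σ W ε) (l : ℤ) (a b : ι) :
    autocov μ W (-l) b a = autocov μ W l a b := by
  have := h.cov_eq (-l) l a b
  rw [neg_add_cancel] at this
  simp only [autocov, Matrix.of_apply]
  rw [covariance_comm, this]

lemma IsStationaryVAR.isHermitian_spectralDensity (h : IsStationaryVAR μ B σ W ε) (θ : ℝ) :
    (spectralDensity μ W θ).IsHermitian := by
  ext a b
  simp only [spectralDensity, Matrix.conjTranspose_apply, Matrix.of_apply, star_mul',
    Complex.star_def, Complex.conj_tsum]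
  congr 1
  · rw [show (1 / (2 * (π : ℂ))) = ((1 / (2 * π) : ℝ) : ℂ) by push_cast; rfl, Complex.conj_ofReal]
  · rw [← (Equiv.neg ℤ).tsum_eq]
    refine tsum_congr fun l => ?_
    simp only [Equiv.neg_apply, map_mul, Complex.conj_ofReal, h.autocov_neg, ← Complex.exp_conj]
    congr 2
    simp

open scoped ComplexOrder in
lemma _root_.Matrix.IsHermitian.diag_re_le_of_spectrum_subset {A : Matrix ι ι ℂ}
    (hA : A.IsHermitian) {lo hi : ℝ} (hs : spectrum ℝ A ⊆ Set.Icc lo hi) (a : ι) :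
    (A a a).re ≤ hi := by
  have hH : (algebraMap ℝ (Matrix ι ι ℂ) hi - A).IsHermitian := by
    refine Matrix.IsHermitian.sub ?_ hA
    rw [Matrix.isHermitian_iff_isSelfAdjoint]
    exact IsSelfAdjoint.algebraMap _ (IsSelfAdjoint.all hi)
  have hpsd : (algebraMap ℝ (Matrix ι ι ℂ) hi - A).PosSemidef := by
    rw [hH.posSemidef_iff_eigenvalues_nonneg]
    intro i
    have hmem := hH.eigenvalues_mem_spectrum_real i
    rw [← spectrum.singleton_sub_eq] at hmem
    obtain ⟨r, hr, s, hs', hrs⟩ := Set.mem_sub.1 hmem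
    rw [Set.mem_singleton_iff] at hr
    have := (hs hs').2
    simp only [Pi.zero_apply]
    rw [← hrs, hr]; linarith
  have hd := (Complex.le_def.1 (hpsd.diag_nonneg (i := a))).1
  simp [Matrix.algebraMap_matrix_apply] at hd
  exact hd

lemma IsStable.tsum_autocov_cos_le (hs : IsStable μ B W lo hi) (h : IsStationaryVAR μ B σ W ε)
    (a : ι) {θ : ℝ} (hθ : θ ∈ Set.Icc (-π) π) :
    ∑' l : ℤ, autocov μ W l a a * Real.cos (l * θ) ≤ 2 * π * hi := by
  have h1 := (h.isHermitian_spectralDensity θ).diag_re_le_of_spectrum_subset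
    (hs.eigenvalues θ hθ) a
  have hsum : Summable fun l : ℤ =>
      (autocov μ W l a a : ℂ) * Complex.exp (-(Complex.I * l * θ)) := by
    refine Summable.of_norm_bounded (hs.summable a a).abs fun l => ?_
    rw [norm_mul, Complex.norm_real, show -(Complex.I * l * θ) = ((-(l * θ) : ℝ) : ℂ) * Complex.I by
      push_cast; ring, Complex.norm_exp_ofReal_mul_I, mul_one, Real.norm_eq_abs]
  have h2 : (spectralDensity μ W θ a a).re =
      (1 / (2 * π)) * ∑' l : ℤ, autocov μ W l a a * Real.cos (l * θ) := by
    have h3 : (1 / (2 * (π : ℂ))) = ((1 / (2 * π) : ℝ) : ℂ) := by push_cast; rfl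
    simp only [spectralDensity, Matrix.of_apply]
    rw [h3, Complex.re_ofReal_mul, Complex.re_tsum hsum]
    congr 1
    refine tsum_congr fun l => ?_
    rw [Complex.re_ofReal_mul, show -(Complex.I * l * θ) = ((-(l * θ) : ℝ) : ℂ) * Complex.I by
      push_cast; ring, Complex.exp_ofReal_mul_I_re, Real.cos_neg]
  rw [h2, one_div, inv_mul_le_iff₀ (by positivity)] at h1
  exact h1

/-- The variance of a linear functional of a coordinate's path is controlled by the upper edge of
the spectral density. -/
lemma IsStable.variance_sum_le (hs : IsStable μ B W lo hi) (h : IsStationaryVAR μ B σ W ε)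
    (a : ι) (τ : ℤ) (x : ℕ → ℝ) (n : ℕ) :
    Var[fun ω => ∑ k ∈ Finset.range n, x k * W (τ + k) ω a; μ] ≤
      2 * π * hi * ∑ k ∈ Finset.range n, x k ^ 2 := by
  rw [variance_fun_sum' (X := fun (k : ℕ) ω => x k * W (τ + k) ω a)
    fun k _ => (h.memLp (τ + k) a).const_mul _]
  refine le_trans (le_of_eq ?_) (sum_sum_toeplitz_le (hs.summable a a)
    (fun θ hθ => hs.tsum_autocov_cos_le h a hθ) x n)
  refine Finset.sum_congr rfl fun j _ => Finset.sum_congr rfl fun k _ => ?_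
  have := h.cov_eq (τ + j) ((k : ℤ) - j) a a
  rw [show τ + j + ((k : ℤ) - j) = τ + k by ring] at this
  rw [covariance_const_mul_left, covariance_const_mul_right, this, mul_assoc]
  rfl

end

/-! ### Typical paths -/

section

variable {ι : Type*} [Fintype ι] [DecidableEq ι] {Ω : Type*} [MeasurableSpace Ω]
variable {μ : Measure Ω} [IsProbabilityMeasure μ] {B : Matrix ι ι ℝ} {σ lo hi : ℝ}
  {W ε : ℤ → Ω → ι → ℝ}

/-- The quadratic exponential moment is obtained from the sub-Gaussian bound by averaging linear
exponential moments over independent standard Gaussian weights: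
`exp (θ ∑ z_k²) = E exp (√(2θ) ∑ g_k z_k)`. -/
lemma IsStable.lintegral_ennexp_sum_sq_le (hs : IsStable μ B W lo hi)
    (h : IsStationaryVAR μ B σ W ε) (hσ : 0 < σ) (hhi : 0 < hi) (a : ι) (τ : ℤ) (n : ℕ) :
    ∫⁻ ω, ennexp ((8 * π * hi)⁻¹ * ∑ k ∈ Finset.range n, W (τ + k) ω a ^ 2) ∂μ ≤
      ennexp (n / 2) := by
  obtain _ | n := n
  · simp [ennexp_zero]
  set θ : ℝ := (8 * π * hi)⁻¹ with hθ
  have hθ0 : 0 < θ := by positivity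
  have hsq : √(2 * θ) ^ 2 = 2 * θ := Real.sq_sqrt (by positivity)
  -- the linearization
  have hlin : ∀ ω, ennexp (θ * ∑ k ∈ Finset.range (n + 1), W (τ + k) ω a ^ 2) =
      ∫⁻ g, ennexp (∑ k : Fin (n + 1), √(2 * θ) * W (τ + (k : ℕ)) ω a * g k)
        ∂(noiseLaw (Fin (n + 1)) 1) := by
    intro ω
    rw [lintegral_ennexp_noiseLaw, Finset.sum_range]
    congr 1
    simp_rw [mul_pow, hsq, ← Finset.mul_sum]
    ring
  have hW : ∀ t, Measurable fun ω => W t ω a := fun t =>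
    (measurable_pi_apply a).comp (h.measurable_W t)
  have hmeas : Measurable fun z : Ω × (Fin (n + 1) → ℝ) =>
      ennexp (∑ k : Fin (n + 1), √(2 * θ) * W (τ + (k : ℕ)) z.1 a * z.2 k) := by
    refine measurable_ennexp.comp (Finset.measurable_fun_sum _ fun k _ => ?_)
    exact (((hW _).comp measurable_fst).const_mul _).mul
      ((measurable_pi_apply k).comp measurable_snd)
  -- for fixed weights the sub-Gaussian bound applies
  have hinner : ∀ g : Fin (n + 1) → ℝ,
      ∫⁻ ω, ennexp (∑ k : Fin (n + 1), √(2 * θ) * W (τ + (k : ℕ)) ω a * g k) ∂μ ≤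
        ∏ k, ennexp (1 / 4 * g k ^ 2) := by
    intro g
    let x : ℕ → ℝ := fun k => if hk : k < n + 1 then √(2 * θ) * g ⟨k, hk⟩ else 0
    have hx : ∀ k : Fin (n + 1), x k = √(2 * θ) * g k := fun k => by simp only [x, k.2, dif_pos, Fin.eta]
    have h1 := h.lintegral_ennexp_sum_dotProduct_le hσ τ n fun k => Pi.single a (x k)
    simp only [single_dotProduct] at h1
    have h2 := hs.variance_sum_le h a τ x (n + 1)
    have h3 : ∀ ω, ∑ k : Fin (n + 1), √(2 * θ) * W (τ + (k : ℕ)) ω a * g k =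
        ∑ k ∈ Finset.range (n + 1), x k * W (τ + k) ω a := by
      intro ω
      rw [Finset.sum_range]
      refine Finset.sum_congr rfl fun k _ => ?_
      rw [hx]; ring
    simp_rw [h3]
    refine h1.trans ?_
    rw [← ennexp_sum]
    refine ennexp_mono ?_
    have h4 : ∑ k ∈ Finset.range (n + 1), x k ^ 2 = 2 * θ * ∑ k, g k ^ 2 := by
      rw [Finset.sum_range, Finset.mul_sum]
      refine Finset.sum_congr rfl fun k _ => ?_
      rw [hx, mul_pow, hsq]
    rw [h4] at h2
    have h5 : 2 * π * hi * (2 * θ * ∑ k, g k ^ 2) = 1 / 2 * ∑ k, g k ^ 2 := by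
      have := Real.pi_pos.ne'
      rw [hθ]; field_simp; ring
    rw [h5] at h2
    rw [← Finset.mul_sum]
    linarith
  calc _ = ∫⁻ ω, ∫⁻ g, ennexp (∑ k : Fin (n + 1), √(2 * θ) * W (τ + (k : ℕ)) ω a * g k)
        ∂(noiseLaw (Fin (n + 1)) 1) ∂μ := lintegral_congr hlin
    _ = ∫⁻ g, ∫⁻ ω, ennexp (∑ k : Fin (n + 1), √(2 * θ) * W (τ + (k : ℕ)) ω a * g k) ∂μ
        ∂(noiseLaw (Fin (n + 1)) 1) := lintegral_lintegral_swap hmeas.aemeasurable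
    _ ≤ ∫⁻ g, ∏ k, ennexp (1 / 4 * g k ^ 2) ∂(noiseLaw (Fin (n + 1)) 1) := lintegral_mono hinner
    _ = ∏ _k : Fin (n + 1), ∫⁻ x, ennexp (1 / 4 * x ^ 2) ∂(gaussianReal 0 ((1 : ℝ) ^ 2).toNNReal) :=
        lintegral_pi_prod _ (fun _ x => ennexp (1 / 4 * x ^ 2)) fun _ => by fun_prop
    _ ≤ ∏ _k : Fin (n + 1), ennexp (1 / 2) := by
        refine Finset.prod_le_prod' fun _ _ => ?_
        refine (lintegral_ennexp_mul_sq_gaussianReal_le one_pos ?_).trans (ennexp_mono ?_)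
        · rw [abs_of_nonneg] <;> norm_num
        · norm_num
    _ = ennexp ((n + 1 : ℕ) / 2) := by
        rw [← ennexp_sum]
        congr 1
        simp [div_eq_mul_inv]

/-- A level that the empirical second moments of the process exceed with exponentially small
probability only. -/
noncomputable def energyBound (hi : ℝ) : ℝ := 20 * π * hi

lemma energyBound_pos (hhi : 0 < hi) : 0 < energyBound hi := by
  unfold energyBound; positivity

lemma IsStable.measure_energyBound_lt_le (hs : IsStable μ B W lo hi)
    (h : IsStationaryVAR μ B σ W ε) (hσ : 0 < σ) (hhi : 0 < hi) (a : ι) (τ : ℤ) (n : ℕ) :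
    μ {ω | energyBound hi * n < ∑ k ∈ Finset.range n, W (τ + k) ω a ^ 2} ≤
      ennexp (-(2 * n)) := by
  have hW : ∀ t, Measurable fun ω => W t ω a := fun t =>
    (measurable_pi_apply a).comp (h.measurable_W t)
  have hm : Measurable fun ω =>
      (8 * π * hi)⁻¹ * ∑ k ∈ Finset.range n, W (τ + k) ω a ^ 2 :=
    (Finset.measurable_fun_sum _ fun k _ => (hW _).pow_const 2).const_mul _
  have h1 := measure_lt_le_of_lintegral_ennexp_le hm
    (hs.lintegral_ennexp_sum_sq_le h hσ hhi a τ n) (5 / 2 * n)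
  refine (measure_mono fun ω hω => ?_).trans (h1.trans_eq ?_)
  · have hp : 0 < 8 * π * hi := by positivity
    simp only [Set.mem_ofPred_eq, energyBound] at hω ⊢
    rw [lt_inv_mul_iff₀ hp]
    linarith
  · congr 1; ring

lemma IsStationaryVAR.lintegral_ennexp_cross_le_one (h : IsStationaryVAR μ B σ W ε) (θ : ℝ)
    (a b : ι) (τ : ℤ) (n : ℕ) :
    ∫⁻ ω, ennexp (∑ k ∈ Finset.range n, (θ * (W (τ + k) ω a * ε (τ + k + 1) ω b) -
      θ ^ 2 * σ ^ 2 / 2 * W (τ + k) ω a ^ 2)) ∂μ ≤ 1 := by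
  simp_rw [ennexp_sum]
  refine h.lintegral_prod_le_one τ (φ := fun _ w e =>
    ennexp (θ * (w a * e b) - θ ^ 2 * σ ^ 2 / 2 * w a ^ 2)) (fun _ => ?_) (fun _ w => ?_) n
  · have h1 : Measurable fun z : (ι → ℝ) × (ι → ℝ) => z.1 a :=
      (measurable_pi_apply a).comp measurable_fst
    have h2 : Measurable fun z : (ι → ℝ) × (ι → ℝ) => z.2 b :=
      (measurable_pi_apply b).comp measurable_snd
    exact measurable_ennexp.comp
      (((h1.mul h2).const_mul _).sub ((h1.pow_const 2).const_mul _))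
  · have h1 : ∀ e : ι → ℝ, ennexp (θ * (w a * e b) - θ ^ 2 * σ ^ 2 / 2 * w a ^ 2) =
        ennexp (-(θ ^ 2 * σ ^ 2 / 2 * w a ^ 2)) * ennexp (θ * w a * e b) := by
      intro e; rw [← ennexp_add]; congr 1; ring
    simp_rw [h1]
    have hm : Measurable fun e : ι → ℝ => ennexp (θ * w a * e b) :=
      measurable_ennexp.comp ((measurable_pi_apply b).const_mul _)
    rw [lintegral_const_mul _ hm]
    have h2 := (measurePreserving_eval
      (fun _ : ι => gaussianReal 0 (σ ^ 2).toNNReal) b).lintegral_comp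
      (f := fun x => ennexp (θ * w a * x)) (by fun_prop)
    simp only [Function.eval] at h2
    rw [h2, lintegral_ennexp_mul_gaussianReal, ← ennexp_add, ← ennexp_zero]
    apply le_of_eq; congr 1; ring

/-- A self-normalized tail bound: the martingale `∑ W_{t,a} ε_{t+1,b}` is small where its
quadratic variation is. -/
lemma IsStationaryVAR.measure_cross_lt_le (h : IsStationaryVAR μ B σ W ε) (θ C x : ℝ)
    (a b : ι) (τ : ℤ) (n : ℕ) :
    μ {ω | ∑ k ∈ Finset.range n, W (τ + k) ω a ^ 2 ≤ C * n ∧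
        x < θ * ∑ k ∈ Finset.range n, W (τ + k) ω a * ε (τ + k + 1) ω b} ≤
      ennexp (θ ^ 2 * σ ^ 2 / 2 * (C * n) - x) := by
  have hW : ∀ t, Measurable fun ω => W t ω a := fun t =>
    (measurable_pi_apply a).comp (h.measurable_W t)
  have hε : ∀ t, Measurable fun ω => ε t ω b := fun t =>
    (measurable_pi_apply b).comp (h.measurable_noise t)
  have hm : Measurable fun ω => ∑ k ∈ Finset.range n,
      (θ * (W (τ + k) ω a * ε (τ + k + 1) ω b) - θ ^ 2 * σ ^ 2 / 2 * W (τ + k) ω a ^ 2) :=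
    Finset.measurable_fun_sum _ fun k _ =>
      (((hW _).mul (hε _)).const_mul _).sub (((hW _).pow_const 2).const_mul _)
  have h0 := h.lintegral_ennexp_cross_le_one θ a b τ n
  rw [← ennexp_zero] at h0
  have h1 := measure_lt_le_of_lintegral_ennexp_le hm h0 (x - θ ^ 2 * σ ^ 2 / 2 * (C * n))
  refine (measure_mono fun ω hω => ?_).trans (h1.trans_eq ?_)
  · obtain ⟨h2, h3⟩ := hω
    have h4 : θ ^ 2 * σ ^ 2 / 2 * ∑ k ∈ Finset.range n, W (τ + k) ω a ^ 2 ≤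
        θ ^ 2 * σ ^ 2 / 2 * (C * n) := by gcongr
    simp only [Set.mem_ofPred_eq, Finset.sum_sub_distrib, ← Finset.mul_sum]
    linarith
  · congr 1; ring

lemma IsStationaryVAR.measure_noise_lt_le (h : IsStationaryVAR μ B σ W ε) (hσ : 0 < σ) {θ : ℝ}
    (hθ : |θ * σ ^ 2| ≤ 1 / 4) (x : ℝ) (a b : ι) (τ : ℤ) (n : ℕ) :
    μ {ω | x < θ * ∑ k ∈ Finset.range n, (ε (τ + k + 1) ω a * ε (τ + k + 1) ω b -
        if a = b then σ ^ 2 else 0)} ≤ ennexp (4 * (θ * σ ^ 2) ^ 2 * n - x) := by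
  have hε : ∀ t c, Measurable fun ω => ε t ω c := fun t c =>
    (measurable_pi_apply c).comp (h.measurable_noise t)
  set D : ℝ := if a = b then σ ^ 2 else 0 with hD
  have hm : Measurable fun ω => ∑ k ∈ Finset.range n,
      (θ * (ε (τ + k + 1) ω a * ε (τ + k + 1) ω b - D) - 4 * (θ * σ ^ 2) ^ 2) :=
    Finset.measurable_fun_sum _ fun k _ =>
      ((((hε _ _).mul (hε _ _)).sub_const _).const_mul _).sub_const _
  have h0 : ∫⁻ ω, ennexp (∑ k ∈ Finset.range n,
      (θ * (ε (τ + k + 1) ω a * ε (τ + k + 1) ω b - D) - 4 * (θ * σ ^ 2) ^ 2)) ∂μ ≤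
      ennexp 0 := by
    rw [ennexp_zero]
    simp_rw [ennexp_sum]
    have hme : Measurable fun e : ι → ℝ => θ * (e a * e b - D) :=
      (((measurable_pi_apply a).mul (measurable_pi_apply b)).sub_const _).const_mul _
    refine h.lintegral_prod_le_one τ (φ := fun _ _ e =>
      ennexp (θ * (e a * e b - D) - 4 * (θ * σ ^ 2) ^ 2)) (fun _ => ?_) (fun _ w => ?_) n
    · exact measurable_ennexp.comp ((hme.sub_const _).comp measurable_snd)
    · simp_rw [sub_eq_add_neg (θ * _), ennexp_add]
      have hmx : Measurable fun e : ι → ℝ => ennexp (θ * (e a * e b - D)) :=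
        measurable_ennexp.comp hme
      rw [lintegral_mul_const _ hmx, mul_comm,
        ← ennexp_neg_mul_self (4 * (θ * σ ^ 2) ^ 2)]
      gcongr
      exact lintegral_ennexp_mul_noiseLaw_le hσ hθ a b
  have h1 := measure_lt_le_of_lintegral_ennexp_le hm h0 (x - 4 * (θ * σ ^ 2) ^ 2 * n)
  refine (measure_mono fun ω hω => ?_).trans (h1.trans_eq ?_)
  · simp only [Set.mem_ofPred_eq] at hω
    simp only [Set.mem_ofPred_eq, Finset.sum_sub_distrib, ← Finset.mul_sum, Finset.sum_const,
      Finset.card_range, nsmul_eq_mul] at hω ⊢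
    linarith
  · congr 1; ring

/-- The scale of the martingale `∑ W_{t,a} ε_{t+1,b}` relative to `√(L T)`. -/
noncomputable def crossBound (hi σ : ℝ) : ℝ := 3 + σ ^ 2 * energyBound hi / 2

/-- A sample path with its innovations on the event where every empirical average that enters the
analysis is within its typical range; `δ` stands for `√(L / T)` with `L` the logarithm of the
dimension. The averages run over two windows, starting at the times `-1` and `0`. -/
structure IsTypical (B : Matrix ι ι ℝ) (σ hi δ : ℝ) (T : ℕ) (x e : ℤ → ι → ℝ) : Prop where
  recursion : ∀ t, x t = B.mulVec (x (t - 1)) + e t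
  energy : ∀ τ, τ = -1 ∨ τ = 0 → ∀ a,
    ∑ k ∈ Finset.range T, x (τ + k) a ^ 2 ≤ energyBound hi * T
  cross : ∀ τ, τ = -1 ∨ τ = 0 → ∀ a b,
    |∑ k ∈ Finset.range T, x (τ + k) a * e (τ + k + 1) b| ≤ crossBound hi σ * δ * T
  noise : ∀ a b, |∑ k ∈ Finset.range T, (e (-1 + k + 1) a * e (-1 + k + 1) b -
    if a = b then σ ^ 2 else 0)| ≤ 16 * σ ^ 2 * δ * T

lemma measure_exists_le {κ : Type*} [Fintype κ] {P : κ → Ω → Prop} {c : ENNReal}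
    (h : ∀ k, μ {ω | P k ω} ≤ c) : μ {ω | ∃ k, P k ω} ≤ Fintype.card κ * c := by
  rw [Set.ofPred_exists]
  refine (measure_iUnion_fintype_le μ _).trans ?_
  refine (Finset.sum_le_sum fun k _ => h k).trans_eq ?_
  simp

lemma natCast_eq_ennexp {n : ℕ} {L : ℝ} (h : (n : ℝ) = Real.exp L) : (n : ENNReal) = ennexp L := by
  rw [ennexp, ← h, ENNReal.ofReal_natCast]

/-- A path is typical with overwhelming probability. -/
lemma IsStable.measure_not_isTypical_le (hs : IsStable μ B W lo hi)
    (h : IsStationaryVAR μ B σ W ε) (hσ : 0 < σ) (hhi : 0 < hi) {L : ℝ} {T : ℕ}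
    (hL : 0 < L) (hLT : L ≤ T) (hcard : (Fintype.card ι : ℝ) = Real.exp L) :
    μ {ω | ¬ IsTypical B σ hi √(L / T) T (fun t => W t ω) (fun t => ε t ω)} ≤
      8 * ennexp (-L) := by
  have hT : (0 : ℝ) < T := hL.trans_le hLT
  set δ := √(L / T) with hδ
  have hδ0 : 0 < δ := Real.sqrt_pos.2 (by positivity)
  have hδ2 : δ ^ 2 * T = L := by
    rw [hδ, Real.sq_sqrt (by positivity)]; field_simp
  have hδ1 : δ ≤ 1 := by
    exact Real.sqrt_le_one.2 ((div_le_one hT).2 hLT)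
  have hN : (Fintype.card ι : ENNReal) = ennexp L := natCast_eq_ennexp hcard
  have hN2 : (Fintype.card (ι × ι) : ENNReal) = ennexp (2 * L) := by
    rw [Fintype.card_prod, Nat.cast_mul, hN, ← ennexp_add, two_mul]
  set C := energyBound hi with hC
  have hE : ∀ τ : ℤ, μ {ω | ∃ a, C * T < ∑ k ∈ Finset.range T, W (τ + k) ω a ^ 2} ≤
      ennexp (-L) := by
    intro τ
    refine (measure_exists_le fun a => hs.measure_energyBound_lt_le h hσ hhi a τ T).trans ?_
    rw [hN, ← ennexp_add]
    exact ennexp_mono (by linarith)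
  have hX : ∀ (τ : ℤ) (s : ℝ), s ^ 2 = 1 →
      μ {ω | ∃ ab : ι × ι, ∑ k ∈ Finset.range T, W (τ + k) ω ab.1 ^ 2 ≤ C * T ∧
        crossBound hi σ * L <
          (s * δ) * ∑ k ∈ Finset.range T, W (τ + k) ω ab.1 * ε (τ + k + 1) ω ab.2} ≤
      ennexp (-L) := by
    intro τ s hs1
    have hb := fun ab : ι × ι =>
      h.measure_cross_lt_le (s * δ) C (crossBound hi σ * L) ab.1 ab.2 τ T
    refine (measure_exists_le hb).trans ?_
    rw [hN2, ← ennexp_add]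
    refine ennexp_mono (le_of_eq ?_)
    rw [mul_pow, hs1, crossBound]
    linear_combination (σ ^ 2 / 2 * C) * hδ2
  have hθ : ∀ s : ℝ, |s| = 1 → |s * δ / (4 * σ ^ 2) * σ ^ 2| ≤ 1 / 4 := by
    intro s hs1
    rw [show s * δ / (4 * σ ^ 2) * σ ^ 2 = s * (δ / 4) by field_simp, abs_mul, hs1, one_mul,
      abs_of_pos (by positivity)]
    linarith
  have hZ : ∀ s : ℝ, |s| = 1 →
      μ {ω | ∃ ab : ι × ι, 4 * L < (s * δ / (4 * σ ^ 2)) * ∑ k ∈ Finset.range T,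
        (ε (-1 + k + 1) ω ab.1 * ε (-1 + k + 1) ω ab.2 - if ab.1 = ab.2 then σ ^ 2 else 0)} ≤
      ennexp (-L) := by
    intro s hs1
    have hb := fun ab : ι × ι => h.measure_noise_lt_le hσ (hθ s hs1) (4 * L) ab.1 ab.2 (-1) T
    refine (measure_exists_le hb).trans ?_
    rw [hN2, ← ennexp_add]
    refine ennexp_mono ?_
    have hs2 : s ^ 2 = 1 := by rw [← sq_abs, hs1, one_pow]
    rw [show s * δ / (4 * σ ^ 2) * σ ^ 2 = s * (δ / 4) by field_simp, mul_pow, hs2]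
    nlinarith
  have hnull : μ {ω | ¬ ∀ t, W t ω = B.mulVec (W (t - 1) ω) + ε t ω} = 0 := h.noise_eq
  have hcover : {ω | ¬ IsTypical B σ hi δ T (fun t => W t ω) (fun t => ε t ω)} ⊆
      {ω | ¬ ∀ t, W t ω = B.mulVec (W (t - 1) ω) + ε t ω} ∪
      (({ω | ∃ a, C * T < ∑ k ∈ Finset.range T, W (-1 + k) ω a ^ 2} ∪
        {ω | ∃ a, C * T < ∑ k ∈ Finset.range T, W (0 + k) ω a ^ 2}) ∪
      (({ω | ∃ ab : ι × ι, ∑ k ∈ Finset.range T, W (-1 + k) ω ab.1 ^ 2 ≤ C * T ∧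
          crossBound hi σ * L <
            (1 * δ) * ∑ k ∈ Finset.range T, W (-1 + k) ω ab.1 * ε (-1 + k + 1) ω ab.2} ∪
        {ω | ∃ ab : ι × ι, ∑ k ∈ Finset.range T, W (-1 + k) ω ab.1 ^ 2 ≤ C * T ∧
          crossBound hi σ * L <
            (-1 * δ) * ∑ k ∈ Finset.range T, W (-1 + k) ω ab.1 * ε (-1 + k + 1) ω ab.2}) ∪
      (({ω | ∃ ab : ι × ι, ∑ k ∈ Finset.range T, W (0 + k) ω ab.1 ^ 2 ≤ C * T ∧
          crossBound hi σ * L <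
            (1 * δ) * ∑ k ∈ Finset.range T, W (0 + k) ω ab.1 * ε (0 + k + 1) ω ab.2} ∪
        {ω | ∃ ab : ι × ι, ∑ k ∈ Finset.range T, W (0 + k) ω ab.1 ^ 2 ≤ C * T ∧
          crossBound hi σ * L <
            (-1 * δ) * ∑ k ∈ Finset.range T, W (0 + k) ω ab.1 * ε (0 + k + 1) ω ab.2}) ∪
      ({ω | ∃ ab : ι × ι, 4 * L < (1 * δ / (4 * σ ^ 2)) * ∑ k ∈ Finset.range T,
          (ε (-1 + k + 1) ω ab.1 * ε (-1 + k + 1) ω ab.2 - if ab.1 = ab.2 then σ ^ 2 else 0)} ∪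
        {ω | ∃ ab : ι × ι, 4 * L < (-1 * δ / (4 * σ ^ 2)) * ∑ k ∈ Finset.range T,
          (ε (-1 + k + 1) ω ab.1 * ε (-1 + k + 1) ω ab.2 -
            if ab.1 = ab.2 then σ ^ 2 else 0)})))) := by
    intro ω hω
    by_contra hcon
    simp only [Set.mem_union, Set.mem_ofPred_eq, not_or, not_not, not_exists, not_lt, not_and,
      Prod.forall] at hcon
    obtain ⟨h1, ⟨h2, h3⟩, ⟨h4, h5⟩, ⟨h6, h7⟩, h8, h9⟩ := hcon
    refine hω ⟨h1, ?_, ?_, ?_⟩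
    · rintro τ (rfl | rfl)
      exacts [h2, h3]
    · have key : ∀ S : ℝ, 1 * δ * S ≤ crossBound hi σ * L → -1 * δ * S ≤ crossBound hi σ * L →
          |S| ≤ crossBound hi σ * δ * T := by
        intro S hS1 hS2
        rw [← hδ2] at hS1 hS2
        rw [abs_le']
        constructor <;> refine le_of_mul_le_mul_left ?_ hδ0 <;> nlinarith
      rintro τ (rfl | rfl) a b
      · exact key _ (h4 a b (h2 a)) (h5 a b (h2 a))
      · exact key _ (h6 a b (h3 a)) (h7 a b (h3 a))
    · intro a b
      have key : ∀ S : ℝ, 1 * δ / (4 * σ ^ 2) * S ≤ 4 * L → -1 * δ / (4 * σ ^ 2) * S ≤ 4 * L →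
          |S| ≤ 16 * σ ^ 2 * δ * T := by
        intro S hS1 hS2
        rw [div_mul_eq_mul_div, div_le_iff₀ (by positivity), ← hδ2] at hS1 hS2
        rw [abs_le']
        constructor <;> refine le_of_mul_le_mul_left ?_ hδ0 <;> nlinarith
      exact key _ (h8 a b) (h9 a b)
  refine (measure_mono hcover).trans ?_
  refine (measure_union_le _ _).trans ?_
  rw [hnull, zero_add]
  have two : ∀ {s t : Set Ω} {c d : ENNReal}, μ s ≤ c → μ t ≤ d → μ (s ∪ t) ≤ c + d :=
    fun hs ht => (measure_union_le _ _).trans (add_le_add hs ht)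
  refine (two (two (hE _) (hE _)) (two (two (hX (-1) 1 (by norm_num)) (hX (-1) (-1) (by norm_num)))
    (two (two (hX 0 1 (by norm_num)) (hX 0 (-1) (by norm_num)))
      (two (hZ 1 (by norm_num)) (hZ (-1) (by norm_num)))))).trans_eq ?_
  ring

end

/-! ### Entrywise norms and bilinear forms of a path -/

section EntrywiseNorm

variable {ι : Type*} [Fintype ι]

/-- The sum of the absolute values of the entries of a matrix. -/
def entryNorm (M : Matrix ι ι ℝ) : ℝ := ∑ i, ∑ a, |M i a|

lemma entryNorm_nonneg (M : Matrix ι ι ℝ) : 0 ≤ entryNorm M :=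
  Finset.sum_nonneg fun _ _ => Finset.sum_nonneg fun _ _ => abs_nonneg _

lemma sum_abs_row_le_entryNorm (M : Matrix ι ι ℝ) (i : ι) : ∑ a, |M i a| ≤ entryNorm M :=
  Finset.single_le_sum (f := fun i => ∑ a, |M i a|)
    (fun _ _ => Finset.sum_nonneg fun _ _ => abs_nonneg _) (Finset.mem_univ i)

lemma entryNorm_mul_le (M N : Matrix ι ι ℝ) : entryNorm (M * N) ≤ entryNorm M * entryNorm N := by
  have h : ∀ i, ∑ a, |(M * N) i a| ≤ (∑ b, |M i b|) * entryNorm N := by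
    intro i
    calc ∑ a, |(M * N) i a| ≤ ∑ a, ∑ b, |M i b| * |N b a| := by
          refine Finset.sum_le_sum fun a _ => ?_
          rw [Matrix.mul_apply]
          refine (Finset.abs_sum_le_sum_abs _ _).trans_eq ?_
          simp_rw [abs_mul]
      _ = ∑ b, |M i b| * ∑ a, |N b a| := by
          rw [Finset.sum_comm]; simp_rw [Finset.mul_sum]
      _ ≤ ∑ b, |M i b| * entryNorm N :=
          Finset.sum_le_sum fun b _ =>
            mul_le_mul_of_nonneg_left (sum_abs_row_le_entryNorm N b) (abs_nonneg _)
      _ = _ := by rw [Finset.sum_mul]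
  calc entryNorm (M * N) ≤ ∑ i, (∑ b, |M i b|) * entryNorm N := Finset.sum_le_sum fun i _ => h i
    _ = _ := by rw [← Finset.sum_mul]; rfl

lemma sum_mulVec_mul_mulVec (M N : Matrix ι ι ℝ) (x y : ℕ → ι → ℝ) (T : ℕ) :
    ∑ k ∈ Finset.range T, ∑ i, M.mulVec (x k) i * N.mulVec (y k) i =
      ∑ i, ∑ a, ∑ b, M i a * N i b * ∑ k ∈ Finset.range T, x k a * y k b := by
  rw [Finset.sum_comm]
  refine Finset.sum_congr rfl fun i _ => ?_
  have : ∀ k, M.mulVec (x k) i * N.mulVec (y k) i =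
      ∑ a, ∑ b, M i a * N i b * (x k a * y k b) := by
    intro k
    simp only [Matrix.mulVec, dotProduct]
    rw [Finset.sum_mul_sum]
    refine Finset.sum_congr rfl fun a _ => Finset.sum_congr rfl fun b _ => ?_
    ring
  simp_rw [this]
  rw [Finset.sum_comm]
  refine Finset.sum_congr rfl fun a _ => ?_
  rw [Finset.sum_comm]
  refine Finset.sum_congr rfl fun b _ => ?_
  rw [Finset.mul_sum]

/-- A uniform bound `C` on the array `c` carries over to the bilinear form it defines. -/
lemma abs_sum_bilinear_le (M N : Matrix ι ι ℝ) {c : ι → ι → ℝ} {C : ℝ} (hC : ∀ a b, |c a b| ≤ C) :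
    |∑ i, ∑ a, ∑ b, M i a * N i b * c a b| ≤ C * ∑ i, (∑ a, |M i a|) * ∑ b, |N i b| := by
  rw [Finset.mul_sum]
  refine (Finset.abs_sum_le_sum_abs _ _).trans (Finset.sum_le_sum fun i _ => ?_)
  rw [Finset.sum_mul_sum, Finset.mul_sum]
  refine (Finset.abs_sum_le_sum_abs _ _).trans (Finset.sum_le_sum fun a _ => ?_)
  rw [Finset.mul_sum]
  refine (Finset.abs_sum_le_sum_abs _ _).trans (Finset.sum_le_sum fun b _ => ?_)
  rw [abs_mul, abs_mul, mul_comm]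
  exact mul_le_mul_of_nonneg_right (hC a b) (by positivity)

lemma sum_row_mul_row_le (M N : Matrix ι ι ℝ) :
    ∑ i, (∑ a, |M i a|) * ∑ b, |N i b| ≤ entryNorm M * entryNorm N := by
  rw [entryNorm, Finset.sum_mul]
  exact Finset.sum_le_sum fun i _ => mul_le_mul_of_nonneg_left (sum_abs_row_le_entryNorm N i)
    (Finset.sum_nonneg fun _ _ => abs_nonneg _)

lemma abs_sum_bilinear_le' (M N : Matrix ι ι ℝ) {c : ι → ι → ℝ} {C : ℝ} (hC0 : 0 ≤ C)
    (hC : ∀ a b, |c a b| ≤ C) :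
    |∑ i, ∑ a, ∑ b, M i a * N i b * c a b| ≤ C * (entryNorm M * entryNorm N) :=
  (abs_sum_bilinear_le M N hC).trans (mul_le_mul_of_nonneg_left (sum_row_mul_row_le M N) hC0)

end EntrywiseNorm

/-! ### The design of the `Γ`-update on a typical path -/

section Blocks

variable {m p : ℕ}

/-- The `m × m` array of a vector of coefficients: the inverse of `betaOf`. -/
def arrayOf (v : Fin m × Fin m → ℝ) : Matrix (Fin m) (Fin m) ℝ := Matrix.of fun i j => v (i, j)

lemma transition_add_right (V : Matrix (Fin m) (Fin m) ℝ) (Θ Θ' : Blocks m p) :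
    transition V (Θ + Θ') = transition V Θ + transition V Θ' := by
  ext a b; simp [transition, mul_add]

lemma entryNorm_transition_le {J₀ : Finset (Fin p × Fin p)} {Θ : Blocks m p}
    (hΘ : SupportedOn J₀ Θ) {r : ℝ} (hr : ∀ i j s s', |Θ i j s s'| ≤ r)
    (v : Fin m × Fin m → ℝ) :
    entryNorm (transition (arrayOf v) Θ) ≤ l1 v * (J₀.card * r) := by
  have h1 : ∀ i j, ∑ s, ∑ s', |Θ i j s s'| ≤ J₀.card * r := by
    intro i j
    rw [← Finset.sum_product', Finset.univ_product_univ, ← nsmul_eq_mul]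
    rw [← Finset.sum_subset (Finset.subset_univ J₀)]
    · exact Finset.sum_le_card_nsmul _ _ _ fun s _ => hr i j s.1 s.2
    · intro s _ hs
      by_contra h
      exact hs (hΘ i j s.1 s.2 (by simpa using h))
  have h2 : entryNorm (transition (arrayOf v) Θ) =
      ∑ i, ∑ j, |v (i, j)| * ∑ s, ∑ s', |Θ i j s s'| := by
    simp only [entryNorm, transition, Matrix.of_apply, arrayOf, abs_mul, Fintype.sum_prod_type,
      Finset.mul_sum]
    refine Finset.sum_congr rfl fun i _ => ?_
    rw [Finset.sum_comm]
  rw [h2, l1, Fintype.sum_prod_type, Finset.sum_mul]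
  refine Finset.sum_le_sum fun i _ => ?_
  rw [Finset.sum_mul]
  exact Finset.sum_le_sum fun j _ => mul_le_mul_of_nonneg_left (h1 i j) (abs_nonneg _)

lemma design_mulVec (T : ℕ) (Θ : Blocks m p) (x : ℕ → Idx m p → ℝ) (v : Fin m × Fin m → ℝ)
    (r : Fin T × Fin m × Fin p) :
    (design T Θ x).mulVec v r = (transition (arrayOf v) Θ).mulVec (x r.1) r.2 := by
  obtain ⟨k, i, s⟩ := r
  simp only [Matrix.mulVec, dotProduct, design, transition, arrayOf, Matrix.of_apply,
    Fintype.sum_prod_type, ite_mul, zero_mul]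
  rw [Finset.sum_eq_single i (fun b _ hb => by simp [hb.symm]) (by simp)]
  simp only [if_true]
  refine Finset.sum_congr rfl fun j _ => ?_
  rw [Finset.sum_mul]
  exact Finset.sum_congr rfl fun s' _ => by ring

lemma design_apply (T : ℕ) (Θ : Blocks m p) (x : ℕ → Idx m p → ℝ) (c : Fin m × Fin m)
    (r : Fin T × Fin m × Fin p) :
    design T Θ x r c = (transition (arrayOf (Pi.single c 1)) Θ).mulVec (x r.1) r.2 := by
  rw [← design_mulVec, Matrix.mulVec_single_one]; rfl

lemma gram_quadratic (T : ℕ) (Θ : Blocks m p) (x : ℕ → Idx m p → ℝ) (v : Fin m × Fin m → ℝ) :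
    v ⬝ᵥ (gram T Θ x).mulVec v =
      (1 / (T : ℝ)) * ∑ k ∈ Finset.range T, ∑ a, (transition (arrayOf v) Θ).mulVec (x k) a ^ 2 := by
  rw [gram, Matrix.smul_mulVec, dotProduct_smul, smul_eq_mul, ← Matrix.mulVec_mulVec,
    Matrix.dotProduct_mulVec, Matrix.vecMul_transpose]
  congr 1
  rw [dotProduct, Finset.sum_range, Fintype.sum_prod_type]
  refine Finset.sum_congr rfl fun k _ => Finset.sum_congr rfl fun a _ => ?_
  rw [design_mulVec, sq]

lemma gram_quadratic_nonneg (T : ℕ) (Θ : Blocks m p) (x : ℕ → Idx m p → ℝ)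
    (v : Fin m × Fin m → ℝ) : 0 ≤ v ⬝ᵥ (gram T Θ x).mulVec v := by
  rw [gram_quadratic]; positivity

lemma gram_symm (T : ℕ) (Θ : Blocks m p) (x : ℕ → Idx m p → ℝ) :
    (gram T Θ x).transpose = gram T Θ x := by
  rw [gram, Matrix.transpose_smul, Matrix.transpose_mul, Matrix.transpose_transpose]

lemma gammaHat_sub_gram (T : ℕ) (Θ : Blocks m p) (x : ℕ → Idx m p → ℝ)
    (Γ : Matrix (Fin m) (Fin m) ℝ) (c : Fin m × Fin m) :
    gammaHat T Θ x c - (gram T Θ x).mulVec (betaOf Γ) c =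
      (1 / (T : ℝ)) * ∑ k ∈ Finset.range T, ∑ a,
        (transition (arrayOf (Pi.single c 1)) Θ).mulVec (x k) a *
          (x (k + 1) a - (transition Γ Θ).mulVec (x k) a) := by
  rw [gammaHat, gram, Matrix.smul_mulVec, ← Matrix.mulVec_mulVec, Pi.smul_apply, Pi.smul_apply,
    ← smul_sub, ← Pi.sub_apply, ← Matrix.mulVec_sub, smul_eq_mul]
  congr 1
  rw [Matrix.mulVec, dotProduct, Finset.sum_range, Fintype.sum_prod_type]
  refine Finset.sum_congr rfl fun k _ => Finset.sum_congr rfl fun a _ => ?_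
  rw [Matrix.transpose_apply, design_apply, Pi.sub_apply, design_mulVec]
  rfl

lemma l1_nonneg {ι : Type*} [Fintype ι] (v : ι → ℝ) : 0 ≤ l1 v :=
  Finset.sum_nonneg fun _ _ => abs_nonneg _

lemma l1_single {ι : Type*} [Fintype ι] [DecidableEq ι] (c : ι) : l1 (Pi.single c (1 : ℝ)) = 1 := by
  rw [l1, Finset.sum_eq_single c]
  · simp
  · intro b _ hb; simp [hb]
  · simp

/-- The pairs `(i, j)` with `γ_{ij} ≠ 0`. -/
noncomputable def activeSet (Γ : Matrix (Fin m) (Fin m) ℝ) : Finset (Fin m × Fin m) :=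
  Finset.univ.filter fun ij => Γ ij.1 ij.2 ≠ 0

lemma l1_betaOf_le {Γ : Matrix (Fin m) (Fin m) ℝ} {C : ℝ} (h : ∀ i j, |Γ i j| ≤ C) :
    l1 (betaOf Γ) ≤ sparsity Γ * C := by
  have h1 : l1 (betaOf Γ) = ∑ c ∈ activeSet Γ, |betaOf Γ c| := by
    refine (Finset.sum_subset (Finset.subset_univ _) fun c _ hc => ?_).symm
    simpa [activeSet, betaOf] using hc
  rw [h1, ← nsmul_eq_mul]
  exact Finset.sum_le_card_nsmul _ _ _ fun c _ => h c.1 c.2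

lemma IsNormalized.abs_le_one {J₀ : Finset (Fin p × Fin p)} {Γ : Matrix (Fin m) (Fin m) ℝ}
    {Θ : Blocks m p} (h : IsNormalized J₀ Γ Θ) (i j : Fin m) (s s' : Fin p) :
    |Θ i j s s'| ≤ 1 := by
  by_cases hΓ : Γ i j = 0
  · simp [h.inactive i j hΓ]
  · have h1 := Real.sqrt_eq_one.1 (h.active i j hΓ)
    rw [← sq_le_one_iff_abs_le_one, ← h1]
    refine le_trans ?_ (Finset.single_le_sum (f := fun s => ∑ s', Θ i j s s' ^ 2)
      (fun _ _ => Finset.sum_nonneg fun _ _ => sq_nonneg _) (Finset.mem_univ s))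
    exact Finset.single_le_sum (f := fun s' => Θ i j s s' ^ 2) (fun _ _ => sq_nonneg _)
      (Finset.mem_univ s')

lemma IsNormalized.sum_transition_sq {J₀ : Finset (Fin p × Fin p)}
    {Γ : Matrix (Fin m) (Fin m) ℝ} {Θ : Blocks m p} (h : IsNormalized J₀ Γ Θ)
    (v : Fin m × Fin m → ℝ) :
    ∑ a, ∑ b, transition (arrayOf v) Θ a b ^ 2 = ∑ c ∈ activeSet Γ, v c ^ 2 := by
  have h1 : ∀ c : Fin m × Fin m, v c ^ 2 * ∑ s, ∑ s', Θ c.1 c.2 s s' ^ 2 =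
      if c ∈ activeSet Γ then v c ^ 2 else 0 := by
    intro c
    by_cases hc : Γ c.1 c.2 = 0
    · simp [activeSet, hc, h.inactive _ _ hc]
    · rw [Real.sqrt_eq_one.1 (h.active _ _ hc)]
      simp [activeSet, hc]
  have h2 : ∑ a, ∑ b, transition (arrayOf v) Θ a b ^ 2 =
      ∑ c : Fin m × Fin m, v c ^ 2 * ∑ s, ∑ s', Θ c.1 c.2 s s' ^ 2 := by
    simp only [transition, Matrix.of_apply, arrayOf, mul_pow, Fintype.sum_prod_type,
      Finset.mul_sum]
    refine Finset.sum_congr rfl fun i _ => ?_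
    rw [Finset.sum_comm]
  rw [h2, Finset.sum_congr rfl fun c _ => h1 c, Finset.sum_ite_mem, Finset.univ_inter]

lemma IsNormalized.entryNorm_transition_le {J₀ : Finset (Fin p × Fin p)}
    {Γ : Matrix (Fin m) (Fin m) ℝ} {Θ : Blocks m p} (h : IsNormalized J₀ Γ Θ)
    (v : Fin m × Fin m → ℝ) :
    entryNorm (transition (arrayOf v) Θ) ≤ (∑ c ∈ activeSet Γ, |v c|) * J₀.card := by
  set w : Fin m × Fin m → ℝ := fun c => if c ∈ activeSet Γ then v c else 0 with hw
  have h1 : transition (arrayOf v) Θ = transition (arrayOf w) Θ := by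
    ext a b
    simp only [transition, Matrix.of_apply, arrayOf, hw]
    split_ifs with hc
    · rfl
    · rw [h.inactive a.1 b.1 (by simpa [activeSet] using hc)]; simp
  have h2 : l1 w = ∑ c ∈ activeSet Γ, |v c| := by
    rw [l1, ← Finset.univ_inter (activeSet Γ), ← Finset.sum_ite_mem]
    refine Finset.sum_congr rfl fun c _ => ?_
    simp only [hw]; split_ifs <;> simp
  have h3 := SpatialVAR.entryNorm_transition_le h.supported h.abs_le_one w
  rwa [← h1, h2, mul_one] at h3

variable {J₀ : Finset (Fin p × Fin p)} {Γ : Matrix (Fin m) (Fin m) ℝ} {Θ Θhat : Blocks m p}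
  {σ hi δ CΓ η : ℝ} {T : ℕ} {x e : ℤ → Idx m p → ℝ}

lemma SupportedOn.sub (h : SupportedOn J₀ Θhat) (h' : SupportedOn J₀ Θ) :
    SupportedOn J₀ (Θhat - Θ) := by
  intro i j s s' hne
  by_contra hmem
  have h1 : Θhat i j s s' = 0 := by_contra fun hn => hmem (h i j s s' hn)
  have h2 : Θ i j s s' = 0 := by_contra fun hn => hmem (h' i j s s' hn)
  exact hne (by simp [h1, h2])

lemma entryNorm_transition_active_le (hN : IsNormalized J₀ Γ Θ) (hΓ : ∀ i j, |Γ i j| ≤ CΓ) :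
    entryNorm (transition Γ Θ) ≤ sparsity Γ * CΓ * J₀.card := by
  have h1 := SpatialVAR.entryNorm_transition_le hN.supported hN.abs_le_one (betaOf Γ)
  rw [mul_one] at h1
  exact h1.trans (mul_le_mul_of_nonneg_right (l1_betaOf_le hΓ) (Nat.cast_nonneg _))

lemma IsTypical.abs_sum_mul_le {B : Matrix (Idx m p) (Idx m p) ℝ} (hx : IsTypical B σ hi δ T x e)
    (a b : Idx m p) :
    |∑ k ∈ Finset.range T, x k a * x k b| ≤ energyBound hi * T := by
  have ha := hx.energy 0 (Or.inr rfl) a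
  have hb := hx.energy 0 (Or.inr rfl) b
  simp only [zero_add] at ha hb
  calc |∑ k ∈ Finset.range T, x k a * x k b|
      ≤ ∑ k ∈ Finset.range T, (x k a ^ 2 + x k b ^ 2) / 2 := by
        refine (Finset.abs_sum_le_sum_abs _ _).trans (Finset.sum_le_sum fun k _ => ?_)
        rw [abs_le]
        constructor
        · nlinarith [sq_nonneg (x k a + x k b)]
        · nlinarith [sq_nonneg (x k a - x k b)]
    _ = ((∑ k ∈ Finset.range T, x k a ^ 2) + ∑ k ∈ Finset.range T, x k b ^ 2) / 2 := by
        rw [← Finset.sum_div, Finset.sum_add_distrib]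
    _ ≤ energyBound hi * T := by linarith

/-- The deviation bound on a typical path: the residual of the true coefficients consists of the
innovations, and of the effect of the estimation error `Θ̂ - Θ⋆` on the active blocks. -/
lemma IsTypical.deviation_le (hx : IsTypical (transition Γ Θ) σ hi δ T x e) (hT : 0 < T)
    (hhi : 0 < hi) (hδ : 0 ≤ δ) (hη : 0 ≤ η) (hN : IsNormalized J₀ Γ Θ)
    (hΓ : ∀ i j, |Γ i j| ≤ CΓ) (hS : SupportedOn J₀ Θhat)
    (hclose : ∀ i j s s', |Θhat i j s s' - Θ i j s s'| ≤ η * δ) :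
    DeviationBound T Θhat (fun t : ℕ => x t) Γ
      ((J₀.card * crossBound hi σ + energyBound hi * J₀.card ^ 2 * sparsity Γ * CΓ * η) *
        (1 + η * δ) * δ) := by
  intro c
  have hT' : (0 : ℝ) < T := by exact_mod_cast hT
  have hE := energyBound_pos hhi
  have hcross : 0 ≤ crossBound hi σ := by unfold crossBound; positivity
  set M := transition (arrayOf (Pi.single c 1)) Θhat with hM
  set D := transition Γ (Θhat - Θ) with hD
  have hbig : ∀ i j s s', |Θhat i j s s'| ≤ 1 + η * δ := by
    intro i j s s'
    calc |Θhat i j s s'| = |Θ i j s s' + (Θhat i j s s' - Θ i j s s')| := by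
          rw [add_sub_cancel]
      _ ≤ 1 + η * δ := (abs_add_le _ _).trans (add_le_add (hN.abs_le_one i j s s')
          (hclose i j s s'))
  have hMn : entryNorm M ≤ J₀.card * (1 + η * δ) := by
    have := entryNorm_transition_le hS hbig (Pi.single c 1)
    rwa [l1_single, one_mul] at this
  have hDn : entryNorm D ≤ sparsity Γ * CΓ * (J₀.card * (η * δ)) := by
    have := entryNorm_transition_le (hS.sub hN.supported) hclose (betaOf Γ)
    exact this.trans (mul_le_mul_of_nonneg_right (l1_betaOf_le hΓ) (by positivity))
  have hres : ∀ k : ℕ, ∀ a, x ((k : ℤ) + 1) a - (transition Γ Θhat).mulVec (x k) a =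
      (1 : Matrix _ _ ℝ).mulVec (e (k + 1)) a - D.mulVec (x k) a := by
    intro k a
    have h1 : transition Γ Θhat = transition Γ Θ + D := by
      rw [hD, ← transition_add_right, add_sub_cancel]
    have h2 := congrFun (hx.recursion (k + 1)) a
    rw [add_sub_cancel_right, Pi.add_apply] at h2
    rw [h2, h1, Matrix.add_mulVec, Matrix.one_mulVec, Pi.add_apply]
    ring
  rw [gammaHat_sub_gram, abs_mul, abs_of_nonneg (by positivity), one_div,
    inv_mul_le_iff₀ hT']
  push_cast
  simp_rw [hres, mul_sub, Finset.sum_sub_distrib]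
  rw [sum_mulVec_mul_mulVec M 1 (fun k => x k) (fun k => e (k + 1)),
    sum_mulVec_mul_mulVec M D (fun k => x k) (fun k => x k)]
  have h1 := abs_sum_bilinear_le M 1
    (c := fun a b => ∑ k ∈ Finset.range T, x k a * e (k + 1) b) fun a b => by
      simpa using hx.cross 0 (Or.inr rfl) a b
  have h2 := abs_sum_bilinear_le' M D (by positivity) hx.abs_sum_mul_le
  have h3 : ∑ i, (∑ a, |M i a|) * ∑ b, |(1 : Matrix (Idx m p) (Idx m p) ℝ) i b| =
      entryNorm M := by
    refine Finset.sum_congr rfl fun i _ => ?_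
    have h4 : ∑ b, |(1 : Matrix (Idx m p) (Idx m p) ℝ) i b| = 1 := by
      rw [Finset.sum_eq_single i]
      · simp
      · intro b _ hb; simp [Matrix.one_apply_ne hb.symm]
      · simp
    rw [h4, mul_one]
  rw [h3] at h1
  refine (abs_sub _ _).trans ((add_le_add h1 h2).trans ?_)
  have h4 : entryNorm M * entryNorm D ≤
      (J₀.card * (1 + η * δ)) * (sparsity Γ * CΓ * (J₀.card * (η * δ))) :=
    mul_le_mul hMn hDn (entryNorm_nonneg _) (by positivity)
  calc _ ≤ crossBound hi σ * δ * T * (J₀.card * (1 + η * δ)) + energyBound hi * T *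
        ((J₀.card * (1 + η * δ)) * (sparsity Γ * CΓ * (J₀.card * (η * δ)))) := by gcongr
    _ = _ := by ring

/-- Restricted curvature on a typical path. The columns of inactive pairs are of the order of the
estimation error, so only the active coefficients are seen by the Gram matrix; for these the
recursion `W_t = B W_{t-1} + ε_t` bounds the energy from below by that of the innovations. -/
lemma IsTypical.curvature (hx : IsTypical (transition Γ Θ) σ hi δ T x e) (hT : 0 < T)
    (hhi : 0 < hi) (hδ : 0 ≤ δ) (hδ1 : δ ≤ 1) (hη : 0 ≤ η) (hN : IsNormalized J₀ Γ Θ)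
    (hΓ : ∀ i j, |Γ i j| ≤ CΓ) (hC : 0 ≤ CΓ) (hS : SupportedOn J₀ Θhat)
    (hclose : ∀ i j s s', |Θhat i j s s' - Θ i j s s'| ≤ η * δ) (v : Fin m × Fin m → ℝ)
    (hcone : l1 v ≤ 4 * ∑ c ∈ activeSet Γ, |v c|) :
    (σ ^ 2 / 2 - δ * (8 * σ ^ 2 * J₀.card ^ 2 * sparsity Γ +
        crossBound hi σ * J₀.card ^ 3 * sparsity Γ ^ 2 * CΓ +
        16 * energyBound hi * sparsity Γ * J₀.card ^ 2 * η ^ 2)) *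
      ∑ c ∈ activeSet Γ, v c ^ 2 ≤ v ⬝ᵥ (gram T Θhat fun t : ℕ => x t).mulVec v := by
  have hT' : (0 : ℝ) < T := by exact_mod_cast hT
  have hE := energyBound_pos hhi
  have hcross : 0 ≤ crossBound hi σ := by unfold crossBound; positivity
  set s₁ := ∑ c ∈ activeSet Γ, |v c| with hs₁
  set n₂ := ∑ c ∈ activeSet Γ, v c ^ 2 with hn₂
  have hs₁0 : 0 ≤ s₁ := Finset.sum_nonneg fun _ _ => abs_nonneg _
  have hCS : s₁ ^ 2 ≤ sparsity Γ * n₂ := by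
    have := sq_sum_le_card_mul_sum_sq (s := activeSet Γ) (f := fun c => |v c|)
    simp only [sq_abs] at this
    exact this
  set A := transition (arrayOf v) Θ with hA
  set D := transition (arrayOf v) (Θhat - Θ) with hD
  set B := transition Γ Θ with hB
  have hsplit : transition (arrayOf v) Θhat = A + D := by
    rw [hA, hD, ← transition_add_right, add_sub_cancel]
  have hAn : entryNorm A ≤ s₁ * J₀.card := hN.entryNorm_transition_le v
  have hDn : entryNorm D ≤ 4 * s₁ * (J₀.card * (η * δ)) :=
    (entryNorm_transition_le (hS.sub hN.supported) hclose v).trans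
      (mul_le_mul_of_nonneg_right hcone (by positivity))
  have hBn : entryNorm B ≤ sparsity Γ * CΓ * J₀.card := entryNorm_transition_active_le hN hΓ
  -- the estimation error
  have hDsum : ∑ k ∈ Finset.range T, ∑ a, D.mulVec (x k) a ^ 2 ≤
      energyBound hi * T * (4 * s₁ * (J₀.card * (η * δ))) ^ 2 := by
    have h1 := abs_sum_bilinear_le' D D (by positivity) hx.abs_sum_mul_le
    rw [← sum_mulVec_mul_mulVec D D (fun k => x k) (fun k => x k)] at h1
    simp_rw [← sq] at h1
    refine (le_abs_self _).trans (h1.trans ?_)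
    have := entryNorm_nonneg D
    gcongr
  -- the interaction of the innovations with the past
  have hcrossA : |∑ k ∈ Finset.range T, ∑ a,
      (A * B).mulVec (x (-1 + k)) a * A.mulVec (e (-1 + k + 1)) a| ≤
      crossBound hi σ * δ * T * (s₁ * J₀.card * (sparsity Γ * CΓ * J₀.card) * (s₁ * J₀.card)) := by
    have h1 := abs_sum_bilinear_le' (A * B) A (by positivity) (hx.cross (-1) (Or.inl rfl))
    rw [← sum_mulVec_mul_mulVec (A * B) A (fun k => x (-1 + k)) (fun k => e (-1 + k + 1))] at h1
    refine h1.trans ?_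
    have := entryNorm_nonneg A
    have := entryNorm_nonneg B
    have h2 := entryNorm_mul_le A B
    gcongr
    exact h2.trans (by gcongr)
  -- the energy of the innovations
  have hnoise : σ ^ 2 * T * n₂ - 16 * σ ^ 2 * δ * T * (s₁ * J₀.card) ^ 2 ≤
      ∑ k ∈ Finset.range T, ∑ a, A.mulVec (e (-1 + k + 1)) a ^ 2 := by
    have h1 := abs_sum_bilinear_le' A A (by positivity) hx.noise
    have h2 : ∑ i, ∑ a, ∑ b, A i a * A i b * ∑ k ∈ Finset.range T,
        (e (-1 + k + 1) a * e (-1 + k + 1) b - if a = b then σ ^ 2 else 0) =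
        (∑ k ∈ Finset.range T, ∑ a, A.mulVec (e (-1 + k + 1)) a ^ 2) - σ ^ 2 * T * n₂ := by
      simp_rw [sq (A.mulVec _ _)]
      rw [sum_mulVec_mul_mulVec A A (fun k => e (-1 + k + 1)) (fun k => e (-1 + k + 1)), hn₂,
        ← hN.sum_transition_sq v, Finset.mul_sum, ← Finset.sum_sub_distrib]
      refine Finset.sum_congr rfl fun i _ => ?_
      rw [Finset.mul_sum, ← Finset.sum_sub_distrib]
      refine Finset.sum_congr rfl fun a _ => ?_
      simp_rw [Finset.sum_sub_distrib, mul_sub, Finset.sum_sub_distrib]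
      congr 1
      rw [Finset.sum_eq_single a]
      · simp; ring
      · intro b _ hb; simp [hb.symm]
      · simp
    rw [h2] at h1
    have h3 := (abs_le.1 h1).1
    have h4 : 16 * σ ^ 2 * δ * T * (entryNorm A * entryNorm A) ≤
        16 * σ ^ 2 * δ * T * (s₁ * J₀.card) ^ 2 := by
      have := entryNorm_nonneg A
      rw [sq (s₁ * _)]
      gcongr
    linarith
  -- dropping the energy of the predictable part
  have hAsum : 2 * (∑ k ∈ Finset.range T, ∑ a,
        (A * B).mulVec (x (-1 + k)) a * A.mulVec (e (-1 + k + 1)) a) +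
      ∑ k ∈ Finset.range T, ∑ a, A.mulVec (e (-1 + k + 1)) a ^ 2 ≤
      ∑ k ∈ Finset.range T, ∑ a, A.mulVec (x k) a ^ 2 := by
    rw [Finset.mul_sum, ← Finset.sum_add_distrib]
    refine Finset.sum_le_sum fun k _ => ?_
    rw [Finset.mul_sum, ← Finset.sum_add_distrib]
    refine Finset.sum_le_sum fun a _ => ?_
    have h1 : A.mulVec (x k) a =
        (A * B).mulVec (x (-1 + k)) a + A.mulVec (e (-1 + k + 1)) a := by
      have h2 := hx.recursion k
      rw [show (k : ℤ) - 1 = -1 + k by ring] at h2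
      rw [h2, Matrix.mulVec_add, Matrix.mulVec_mulVec, Pi.add_apply,
        show -1 + (k : ℤ) + 1 = k by ring]
    rw [h1]
    nlinarith [sq_nonneg ((A * B).mulVec (x (-1 + k)) a)]
  have hgram : (1 / 2) * (∑ k ∈ Finset.range T, ∑ a, A.mulVec (x k) a ^ 2) -
      ∑ k ∈ Finset.range T, ∑ a, D.mulVec (x k) a ^ 2 ≤
      ∑ k ∈ Finset.range T, ∑ a, (transition (arrayOf v) Θhat).mulVec (x k) a ^ 2 := by
    rw [Finset.mul_sum, ← Finset.sum_sub_distrib]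
    refine Finset.sum_le_sum fun k _ => ?_
    rw [Finset.mul_sum, ← Finset.sum_sub_distrib]
    refine Finset.sum_le_sum fun a _ => ?_
    rw [hsplit, Matrix.add_mulVec, Pi.add_apply]
    nlinarith [sq_nonneg (A.mulVec (x k) a + 2 * D.mulVec (x k) a)]
  rw [gram_quadratic, one_div, le_inv_mul_iff₀ hT']
  have hcr := (abs_le.1 hcrossA).1
  have hc1 : s₁ ^ 2 * (T * δ * (8 * σ ^ 2 * J₀.card ^ 2 +
      crossBound hi σ * J₀.card ^ 3 * sparsity Γ * CΓ +
      16 * energyBound hi * J₀.card ^ 2 * η ^ 2)) ≤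
      sparsity Γ * n₂ * (T * δ * (8 * σ ^ 2 * J₀.card ^ 2 +
      crossBound hi σ * J₀.card ^ 3 * sparsity Γ * CΓ +
      16 * energyBound hi * J₀.card ^ 2 * η ^ 2)) :=
    mul_le_mul_of_nonneg_right hCS (by positivity)
  have hc2 : energyBound hi * T * (4 * s₁ * (J₀.card * (η * δ))) ^ 2 ≤
      s₁ ^ 2 * (T * δ * (16 * energyBound hi * J₀.card ^ 2 * η ^ 2)) := by
    have : s₁ ^ 2 * (T * δ * (16 * energyBound hi * J₀.card ^ 2 * η ^ 2)) * δ ≤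
        s₁ ^ 2 * (T * δ * (16 * energyBound hi * J₀.card ^ 2 * η ^ 2)) :=
      mul_le_of_le_one_right (by positivity) hδ1
    refine le_trans (le_of_eq ?_) this
    ring
  refine le_trans ?_ hgram
  refine le_trans ?_ (sub_le_sub (mul_le_mul_of_nonneg_left hAsum (by norm_num)) hDsum)
  refine le_trans ?_ (sub_le_sub_left hc2 _)
  linarith

end Blocks

/-! ### The Lasso on a typical path -/

section Lasso

variable {m p : ℕ} {T : ℕ} {Θ : Blocks m p} {x : ℕ → Idx m p → ℝ}
  {Γ : Matrix (Fin m) (Fin m) ℝ} {d lam : ℝ} {β : Fin m × Fin m → ℝ}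

lemma abs_dotProduct_le_l1 {ι : Type*} [Fintype ι] (v w : ι → ℝ) {d : ℝ} (h : ∀ k, |w k| ≤ d) :
    |v ⬝ᵥ w| ≤ d * l1 v := by
  rw [dotProduct, l1, Finset.mul_sum]
  refine (Finset.abs_sum_le_sum_abs _ _).trans (Finset.sum_le_sum fun k _ => ?_)
  rw [abs_mul, mul_comm]
  exact mul_le_mul_of_nonneg_right (h k) (abs_nonneg _)

/-- The restricted eigenvalue condition with equal constants holds since `‖u‖₂ ≤ ‖u‖₁`. The
constants cannot be improved in general: an inactive pair may have the zero block as its estimate,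
and on the corresponding coordinate vector the Gram matrix vanishes. -/
lemma gram_RE (T : ℕ) (Θ : Blocks m p) (x : ℕ → Idx m p → ℝ) {α : ℝ} (hα : 0 ≤ α) :
    RE (gram T Θ x) α α := by
  intro u
  have h1 : ∑ k, u k ^ 2 ≤ l1 u ^ 2 := by
    have := Finset.sum_sq_le_sq_sum_of_nonneg (s := Finset.univ) (f := fun k => |u k|)
      fun k _ => abs_nonneg _
    simp only [sq_abs] at this
    exact this
  have h2 := mul_le_mul_of_nonneg_left h1 hα
  linarith [gram_quadratic_nonneg T Θ x u]

/-- The basic inequality: a minimizer does at least as well as the true coefficients. -/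
lemma basic_inequality (hdev : DeviationBound T Θ x Γ d) (hlam : 4 * d ≤ lam)
    (hmin : IsMinOn (objective T Θ x lam) Set.univ β) :
    (β - betaOf Γ) ⬝ᵥ (gram T Θ x).mulVec (β - betaOf Γ) + lam * (l1 β - l1 (betaOf Γ)) ≤
      lam / 2 * l1 (β - betaOf Γ) := by
  have h0 : objective T Θ x lam β ≤ objective T Θ x lam (betaOf Γ) := hmin (Set.mem_univ _)
  set b := betaOf Γ
  set v := β - b with hv
  have hβ : β = b + v := by rw [hv, add_sub_cancel]
  set A := gram T Θ x
  set g := gammaHat T Θ x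
  have hsymm : b ⬝ᵥ A.mulVec v = v ⬝ᵥ A.mulVec b := by
    rw [Matrix.dotProduct_mulVec, dotProduct_comm, ← Matrix.mulVec_transpose, gram_symm]
  have h1 := (abs_le.1 (abs_dotProduct_le_l1 v (g - A.mulVec b) hdev)).2
  rw [dotProduct_sub] at h1
  have h2 : β ⬝ᵥ A.mulVec β = b ⬝ᵥ A.mulVec b + 2 * (v ⬝ᵥ A.mulVec b) + v ⬝ᵥ A.mulVec v := by
    rw [hβ, Matrix.mulVec_add, dotProduct_add, add_dotProduct, add_dotProduct, hsymm]; ring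
  have h3 : β ⬝ᵥ g = b ⬝ᵥ g + v ⬝ᵥ g := by rw [hβ, add_dotProduct]
  unfold objective at h0
  rw [h2, h3] at h0
  have h4 := mul_le_mul_of_nonneg_right hlam (l1_nonneg v)
  linarith

/-- Without any curvature the error of a Lasso estimate is of the order of the true
coefficients. -/
lemma l1_error_le_four_mul (hlam0 : 0 < lam) (hdev : DeviationBound T Θ x Γ d)
    (hlam : 4 * d ≤ lam) (hmin : IsMinOn (objective T Θ x lam) Set.univ β) :
    l1 (β - betaOf Γ) ≤ 4 * l1 (betaOf Γ) := by
  have h := basic_inequality hdev hlam hmin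
  have h1 := gram_quadratic_nonneg T Θ x (β - betaOf Γ)
  have h2 : l1 (β - betaOf Γ) ≤ l1 β + l1 (betaOf Γ) := by
    unfold l1
    rw [← Finset.sum_add_distrib]
    exact Finset.sum_le_sum fun k _ => abs_sub _ _
  have h3 : l1 β - l1 (betaOf Γ) ≤ 1 / 2 * l1 (β - betaOf Γ) := by
    refine le_of_mul_le_mul_left ?_ hlam0
    linarith
  linarith

/-- The error of a Lasso estimate lies in the cone of the active set, and its quadratic form is
controlled by the penalty on the active coordinates. -/
lemma cone_inequality (hdev : DeviationBound T Θ x Γ d)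
    (hlam : 4 * d ≤ lam) (hlam0 : 0 < lam)
    (hmin : IsMinOn (objective T Θ x lam) Set.univ β) :
    l1 (β - betaOf Γ) ≤ 4 * ∑ c ∈ activeSet Γ, |(β - betaOf Γ) c| ∧
      (β - betaOf Γ) ⬝ᵥ (gram T Θ x).mulVec (β - betaOf Γ) ≤
        3 / 2 * lam * ∑ c ∈ activeSet Γ, |(β - betaOf Γ) c| := by
  have h := basic_inequality hdev hlam hmin
  have h1 := gram_quadratic_nonneg T Θ x (β - betaOf Γ)
  set b := betaOf Γ with hb
  set v := β - b with hv
  set S := activeSet Γ with hS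
  have hsplit : ∀ f : Fin m × Fin m → ℝ, l1 f = ∑ c ∈ S, |f c| + ∑ c ∈ Sᶜ, |f c| := fun f =>
    (Finset.sum_add_sum_compl S _).symm
  have hb0 : ∀ c ∈ Sᶜ, b c = 0 := fun c hc => by
    simpa [hS, activeSet, hb, betaOf] using hc
  have h2 : l1 b = ∑ c ∈ S, |b c| := by
    rw [hsplit, Finset.sum_eq_zero (s := Sᶜ) fun c hc => by rw [hb0 c hc, abs_zero], add_zero]
  have h3 : ∑ c ∈ S, |b c| - ∑ c ∈ S, |v c| ≤ ∑ c ∈ S, |β c| := by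
    rw [← Finset.sum_sub_distrib]
    refine Finset.sum_le_sum fun c _ => ?_
    have := abs_sub_abs_le_abs_sub (b c) (β c)
    rw [abs_sub_comm] at this
    simp only [hv, Pi.sub_apply]
    linarith
  have h4 : ∑ c ∈ Sᶜ, |β c| = ∑ c ∈ Sᶜ, |v c| :=
    Finset.sum_congr rfl fun c hc => by rw [hv, Pi.sub_apply, hb0 c hc, sub_zero]
  have h5 : ∑ c ∈ Sᶜ, |v c| - ∑ c ∈ S, |v c| ≤ l1 β - l1 b := by
    rw [hsplit β, h2, h4]; linarith
  have h6 := mul_le_mul_of_nonneg_left h5 hlam0.le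
  have h7 := hsplit v
  have h8 : 0 ≤ ∑ c ∈ Sᶜ, |v c| := Finset.sum_nonneg fun _ _ => abs_nonneg _
  rw [h7] at h ⊢
  constructor
  · have : ∑ c ∈ Sᶜ, |v c| ≤ 3 * ∑ c ∈ S, |v c| := by
      refine le_of_mul_le_mul_left ?_ hlam0
      linarith
    linarith
  · nlinarith

/-- Curvature `κ` on the cone turns into an `ℓ₁` error bound. -/
lemma l1_error_le {κ : ℝ} (hκ : 0 < κ) (hdev : DeviationBound T Θ x Γ d)
    (hlam : 4 * d ≤ lam) (hlam0 : 0 < lam)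
    (hmin : IsMinOn (objective T Θ x lam) Set.univ β)
    (hcurv : ∀ v : Fin m × Fin m → ℝ, l1 v ≤ 4 * ∑ c ∈ activeSet Γ, |v c| →
      κ * ∑ c ∈ activeSet Γ, v c ^ 2 ≤ v ⬝ᵥ (gram T Θ x).mulVec v) :
    l1 (β - betaOf Γ) ≤ 6 * sparsity Γ / κ * lam := by
  obtain ⟨h1, h2⟩ := cone_inequality hdev hlam hlam0 hmin
  have h3 := hcurv _ h1
  set v := β - betaOf Γ
  set s₁ := ∑ c ∈ activeSet Γ, |v c|
  have hs₁ : 0 ≤ s₁ := Finset.sum_nonneg fun _ _ => abs_nonneg _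
  have hCS : s₁ ^ 2 ≤ sparsity Γ * ∑ c ∈ activeSet Γ, v c ^ 2 := by
    have := sq_sum_le_card_mul_sum_sq (s := activeSet Γ) (f := fun c => |v c|)
    simp only [sq_abs] at this
    exact this
  have h4 : κ * s₁ ≤ sparsity Γ * (3 / 2 * lam) := by
    rcases hs₁.eq_or_lt with h0 | h0
    · rw [← h0]; simp; positivity
    · refine le_of_mul_le_mul_right ?_ h0
      calc κ * s₁ * s₁ = κ * s₁ ^ 2 := by ring
        _ ≤ κ * (sparsity Γ * ∑ c ∈ activeSet Γ, v c ^ 2) := by gcongr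
        _ = sparsity Γ * (κ * ∑ c ∈ activeSet Γ, v c ^ 2) := by ring
        _ ≤ sparsity Γ * (3 / 2 * lam * s₁) :=
          mul_le_mul_of_nonneg_left (h3.trans h2) (Nat.cast_nonneg _)
        _ = _ := by ring
  rw [div_mul_eq_mul_div, le_div_iff₀ hκ]
  nlinarith

end Lasso

/-! ### The deviation function -/

section Deviation

/-- The loss of curvature per unit of `√(L / T)`. -/
noncomputable def curvatureLoss (hi σ CΓ η : ℝ) (sΓ sΩ : ℕ) : ℝ :=
  8 * σ ^ 2 * sΩ ^ 2 * sΓ + crossBound hi σ * sΩ ^ 3 * sΓ ^ 2 * CΓ +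
    16 * energyBound hi * sΓ * sΩ ^ 2 * η ^ 2

/-- The scale of the deviation function. Its first two terms bound the deviation. The third one
makes the Lasso bound hold for trivial reasons where `√(L / T)` is too large for curvature. -/
noncomputable def deviationScale (hi σ CΓ η : ℝ) (sΓ sΩ : ℕ) : ℝ :=
  sΩ * crossBound hi σ + energyBound hi * sΩ ^ 2 * sΓ * CΓ * η +
    curvatureLoss hi σ CΓ η sΓ sΩ * CΓ + 1

variable {hi σ CΓ η : ℝ}

lemma crossBound_nonneg (hhi : 0 < hi) : 0 ≤ crossBound hi σ := by
  have := energyBound_pos hhi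
  unfold crossBound; positivity

lemma curvatureLoss_nonneg (hhi : 0 < hi) (hC : 0 < CΓ) (sΓ sΩ : ℕ) :
    0 ≤ curvatureLoss hi σ CΓ η sΓ sΩ := by
  have := energyBound_pos hhi
  have := crossBound_nonneg (σ := σ) hhi
  unfold curvatureLoss; positivity

lemma deviationScale_pos (hhi : 0 < hi) (hC : 0 < CΓ) (hη : 0 < η) (sΓ sΩ : ℕ) :
    0 < deviationScale hi σ CΓ η sΓ sΩ := by
  have := energyBound_pos hhi
  have := crossBound_nonneg (σ := σ) hhi
  have := curvatureLoss_nonneg (σ := σ) (η := η) hhi hC sΓ sΩ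
  unfold deviationScale; positivity

variable {m p T : ℕ} {J₀ : Finset (Fin p × Fin p)} {Γ : Matrix (Fin m) (Fin m) ℝ}
  {Θ Θhat : Blocks m p} {δ : ℝ} {x e : ℤ → Idx m p → ℝ}

lemma IsTypical.deviationBound (hx : IsTypical (transition Γ Θ) σ hi δ T x e) (hT : 0 < T)
    (hhi : 0 < hi) (hδ : 0 ≤ δ) (hη : 0 < η) (hN : IsNormalized J₀ Γ Θ)
    (hΓ : ∀ i j, |Γ i j| ≤ CΓ) (hC : 0 < CΓ) (hS : SupportedOn J₀ Θhat)
    (hclose : ∀ i j s s', |Θhat i j s s' - Θ i j s s'| ≤ η * δ) :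
    DeviationBound T Θhat (fun t : ℕ => x t) Γ
      (deviationScale hi σ CΓ η (sparsity Γ) J₀.card * (1 + η * δ) * δ) := by
  intro c
  refine (hx.deviation_le hT hhi hδ hη.le hN hΓ hS hclose c).trans ?_
  have := curvatureLoss_nonneg (σ := σ) (η := η) hhi hC (sparsity Γ) J₀.card
  gcongr
  unfold deviationScale
  have : 0 ≤ curvatureLoss hi σ CΓ η (sparsity Γ) J₀.card * CΓ := by positivity
  linarith

lemma IsTypical.l1_error_le (hx : IsTypical (transition Γ Θ) σ hi δ T x e) (hT : 0 < T)
    (hσ : 0 < σ) (hhi : 0 < hi) (hδ : 0 < δ) (hδ1 : δ ≤ 1) (hη : 0 < η)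
    (hN : IsNormalized J₀ Γ Θ) (hΓ : ∀ i j, |Γ i j| ≤ CΓ) (hC : 0 < CΓ)
    (hS : SupportedOn J₀ Θhat)
    (hclose : ∀ i j s s', |Θhat i j s s' - Θ i j s s'| ≤ η * δ) {lam : ℝ}
    (hlam : 4 * (deviationScale hi σ CΓ η (sparsity Γ) J₀.card * (1 + η * δ) * δ) ≤ lam)
    {β : Fin m × Fin m → ℝ}
    (hmin : IsMinOn (objective T Θhat (fun t : ℕ => x t) lam) Set.univ β) :
    l1 (β - betaOf Γ) ≤ 48 * sparsity Γ / σ ^ 2 * lam := by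
  set K := deviationScale hi σ CΓ η (sparsity Γ) J₀.card with hK
  set R := curvatureLoss hi σ CΓ η (sparsity Γ) J₀.card with hR
  have hK0 : 0 < K := deviationScale_pos hhi hC hη _ _
  have hR0 : 0 ≤ R := curvatureLoss_nonneg hhi hC _ _
  have hlam0 : 0 < lam := lt_of_lt_of_le (by positivity) hlam
  have hdev := hx.deviationBound hT hhi hδ.le hη hN hΓ hC hS hclose
  rw [← hK] at hdev
  rcases le_or_gt (δ * R) (σ ^ 2 / 4) with hsmall | hlarge
  · have h1 := SpatialVAR.l1_error_le (κ := σ ^ 2 / 4) (by positivity) hdev hlam hlam0 hmin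
      fun v hv => by
        refine le_trans (mul_le_mul_of_nonneg_right ?_
          (Finset.sum_nonneg fun _ _ => sq_nonneg _))
          (hx.curvature hT hhi hδ.le hδ1 hη.le hN hΓ hC.le hS hclose v hv)
        rw [hR, curvatureLoss] at hsmall
        linarith
    refine h1.trans (mul_le_mul_of_nonneg_right ?_ hlam0.le)
    rw [div_le_div_iff₀ (by positivity) (by positivity)]
    have : (0 : ℝ) ≤ sparsity Γ * σ ^ 2 := by positivity
    nlinarith
  · have hRC : R * CΓ ≤ K := by
      have := energyBound_pos hhi
      have := crossBound_nonneg (σ := σ) hhi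
      rw [hK, deviationScale, ← hR]
      have : 0 ≤ J₀.card * crossBound hi σ +
          energyBound hi * J₀.card ^ 2 * sparsity Γ * CΓ * η := by positivity
      linarith
    have h1 := (l1_error_le_four_mul hlam0 hdev hlam hmin).trans
      (mul_le_mul_of_nonneg_left (l1_betaOf_le hΓ) (by norm_num))
    have h2 : σ ^ 2 * CΓ ≤ lam := by
      calc σ ^ 2 * CΓ ≤ 4 * (δ * R) * CΓ := by gcongr; linarith
        _ = 4 * δ * (R * CΓ) := by ring
        _ ≤ 4 * δ * K := by gcongr
        _ = 4 * (K * 1 * δ) := by ring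
        _ ≤ 4 * (K * (1 + η * δ) * δ) := by
          have : 0 ≤ η * δ := by positivity
          gcongr; linarith
        _ ≤ lam := hlam
    refine h1.trans ?_
    rw [div_mul_eq_mul_div, le_div_iff₀ (by positivity)]
    have h3 : (sparsity Γ : ℝ) * (σ ^ 2 * CΓ) ≤ sparsity Γ * lam := by gcongr
    have h4 : (0 : ℝ) ≤ sparsity Γ * lam := by positivity
    nlinarith

end Deviation

end SpatialVAR

theorem theorem2 :
    -- universal constants
    ∃ c₁ > (0 : ℝ), ∃ c₂ > (0 : ℝ), ∃ c₃ > (0 : ℝ), ∃ c₄ > (0 : ℝ), ∃ C₀ > (0 : ℝ),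
    -- stability constants and noise level determine the curvature constants
    ∀ lo > (0 : ℝ), ∀ hi > (0 : ℝ), ∀ σ > (0 : ℝ),
    ∃ αΓ > (0 : ℝ), ∃ φΓ ≥ (0 : ℝ),
    -- bound on `Γ`, sparsity levels and radius constant determine the deviation function
    ∀ CΓ > (0 : ℝ), ∀ sΓ sΩ : ℕ, ∀ η > (0 : ℝ),
    ∃ Q : ℝ → ℝ → ℝ,
      (∀ r ≥ 0, ∀ ν ≥ 0, 0 < Q r ν) ∧
      (∀ r r' ν ν', 0 ≤ r → r ≤ r' → 0 ≤ ν → ν ≤ ν' → Q r ν ≤ Q r' ν') ∧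
    ∀ (m p T : ℕ), 2 ≤ m → 1 ≤ p → C₀ * (Real.log m + Real.log p) ≤ T →
    ∀ (J₀ : Finset (Fin p × Fin p)) (Γ : Matrix (Fin m) (Fin m) ℝ) (Θ : SpatialVAR.Blocks m p),
      J₀.card = sΩ → SpatialVAR.sparsity Γ = sΓ → SpatialVAR.IsNormalized J₀ Γ Θ →
      (∀ i j, |Γ i j| ≤ CΓ) →
    ∀ {Ω : Type*} [MeasurableSpace Ω] (μ : Measure Ω) [IsProbabilityMeasure μ]
      (W ε : ℤ → Ω → SpatialVAR.Idx m p → ℝ),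
      SpatialVAR.IsStationaryVAR μ (SpatialVAR.transition Γ Θ) σ W ε →
      SpatialVAR.IsStable μ (SpatialVAR.transition Γ Θ) W lo hi →
    ∀ ν q : ℝ, ν = η * √((Real.log p + Real.log m) / T) →
      q = Q (Real.log p / Real.log m) ν →
      μ {ω | ¬ ∀ Θhat : SpatialVAR.Blocks m p,
          SpatialVAR.SupportedOn J₀ Θhat →
          (∀ i j s s', |Θhat i j s s' - Θ i j s s'| ≤ ν) →
          SpatialVAR.RE (SpatialVAR.gram T Θhat fun t => W t ω) αΓ φΓ ∧
          SpatialVAR.DeviationBound T Θhat (fun t => W t ω) Γ (q * √(Real.log m / T)) ∧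
          ∀ lam : ℝ, 4 * q * √(Real.log m / T) ≤ lam →
          ∀ βhat : Fin m × Fin m → ℝ,
            IsMinOn (SpatialVAR.objective T Θhat (fun t => W t ω) lam) Set.univ βhat →
            SpatialVAR.l1 (βhat - SpatialVAR.betaOf Γ) ≤ 48 * sΓ / αΓ * lam}
        ≤ ENNReal.ofReal
            (c₁ * Real.exp (-c₂ * (Real.log m + Real.log p)) + c₃ * (T : ℝ) ^ (-c₄)) := by
  refine ⟨8, by norm_num, 1, one_pos, 1, one_pos, 1, one_pos, 1, one_pos, ?_⟩
  intro lo _ hi hhi σ hσ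
  refine ⟨σ ^ 2, by positivity, σ ^ 2, by positivity, ?_⟩
  intro CΓ hC sΓ sΩ η hη
  have hK := SpatialVAR.deviationScale_pos (σ := σ) hhi hC hη sΓ sΩ
  refine ⟨fun r ν => SpatialVAR.deviationScale hi σ CΓ η sΓ sΩ * (1 + ν) * √(1 + r),
    fun r hr ν hν => by positivity, fun r r' ν ν' hr hrr hν hνν => by
      have := hν.trans hνν
      dsimp only
      gcongr, ?_⟩
  intro m p T hm hp hT J₀ Γ Θ hJ hsΓ hN hΓ Ω _ μ _ W ε hW hst ν q hν hq
  subst hJ hsΓ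
  have hm' : (2 : ℝ) ≤ m := by exact_mod_cast hm
  have hp' : (1 : ℝ) ≤ p := by exact_mod_cast hp
  have hlogm : 0 < Real.log m := Real.log_pos (by linarith)
  have hlogp : 0 ≤ Real.log p := Real.log_nonneg hp'
  set L := Real.log m + Real.log p with hL
  have hL0 : 0 < L := by positivity
  rw [one_mul] at hT
  have hT0 : (0 : ℝ) < T := hL0.trans_le hT
  have hTn : 0 < T := by exact_mod_cast hT0
  set δ := √(L / T) with hδ
  have hδ0 : 0 < δ := Real.sqrt_pos.2 (by positivity)
  have hδ1 : δ ≤ 1 := Real.sqrt_le_one.2 ((div_le_one hT0).2 hT)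
  have hν' : ν = η * δ := by rw [hν, hδ, hL, add_comm]
  have hcard : (Fintype.card (SpatialVAR.Idx m p) : ℝ) = Real.exp L := by
    rw [hL, Real.exp_add, Real.exp_log (by linarith), Real.exp_log (by linarith)]
    simp
  -- the factor `√(1 + log p / log m)` turns `√(log m / T)` into `√((log m + log p) / T)`
  have hqδ : q * √(Real.log m / T) =
      SpatialVAR.deviationScale hi σ CΓ η (SpatialVAR.sparsity Γ) J₀.card * (1 + η * δ) * δ := by
    rw [hq, hν', mul_assoc _ √_, ← Real.sqrt_mul (by positivity)]
    congr 2
    rw [hL]; field_simp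
  have hgood := hst.measure_not_isTypical_le hW hσ hhi hL0 hT hcard
  refine (measure_mono fun ω hω => ?_).trans (hgood.trans ?_)
  · intro hx
    refine hω fun Θhat hS hclose => ?_
    rw [hν'] at hclose
    refine ⟨SpatialVAR.gram_RE _ _ _ (sq_nonneg σ), ?_, ?_⟩
    · rw [hqδ]
      exact hx.deviationBound hTn hhi hδ0.le hη hN hΓ hC hS hclose
    · intro lam hlam β hmin
      rw [mul_assoc, hqδ] at hlam
      exact hx.l1_error_le hTn hσ hhi hδ0 hδ1 hη hN hΓ hC hS hclose hlam hmin
  · rw [SpatialVAR.ennexp, ← ENNReal.ofReal_ofNat, ← ENNReal.ofReal_mul (by norm_num)]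
    refine ENNReal.ofReal_le_ofReal ?_
    rw [neg_one_mul]
    have : 0 ≤ (T : ℝ) ^ (-1 : ℝ) := by positivity
    linarith
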